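/- The following principles are statements about sets, formulated in the language of set theory. A set is finite if it is in bijection with a natural number (an element of $\omega$) and infinite otherwise; it is Dedekind-infinite if $\omega$ injects into it, and countable if it injects into $\omega$. For a set $X$, $[X]^2$ denotes the set of all two-element subsets of $X$, and $[X]^{<\omega}$ the set of all finite subsets of $X$. For $Y\subseteq[X]^{<\omega}$ let $$\mathrm{FU}(Y)=\Big\{\bigcup_{y\in F}y \;:\; F\in[Y]^{<\omega}\setminus\{\varnothing\}\Big\}.$$ For a function $c$, a set $S$ contained in the domain of $c$ is called $c$-monochromatic if $c$ is constant on $S$. - $\mathrm{Fin}=\mathrm{D\text{-}Fin}$: every infinite set is Dedekind-infinite. - $\mathsf{RT}$ (Ramsey's theorem): for every infinite set $X$ and every $c:[X]^2\to 2$ there is an infinite $Y\subseteq X$ such that $[Y]^2$ is $c$-monochromatic. - $\mathsf{KL}$ (König's lemma): every countable family of nonempty finite sets admits a choice function. - $\mathsf{HT}$ (Hindman's theorem): for every infinite set $X$ and every $c:[X]^{<\omega}\to 2$ there is an infinite, pairwise disjoint family $Y\subseteq[X]^{<\omega}$ such that $\mathrm{FU}(Y)$ is $c$-monochromatic. **Proposition.**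 In $\mathsf{ZF}$ (Zermelo–Fraenkel set theory without the Axiom of Choice) the following are equivalent; that is, in every model of $\mathsf{ZF}$ either all three of them hold or none does: 1. $\mathrm{Fin}=\mathrm{D\text{-}Fin}$; 2. $\mathsf{RT}\wedge\mathsf{HT}$; 3. $\mathsf{KL}\wedge\mathsf{HT}$. -/

import Mathlib

/-!
Statements "in ZF" are formalized as truth in every model of the first-order theory ZF (which, by
Gödel's completeness theorem, is the same as provability from ZF).  A structure for the language of
set theory is a type `M` with one binary relation `∈ᴹ`; its elements are the "sets".  All notions
below are the *internal* ones: every quantifier ranges over elements of `M`, and the only atomic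
formulas are `x ∈ᴹ y` and `x = y`, so that each closed notion is the Tarskian truth in `M`
of the corresponding sentence of the language of set theory.
-/

namespace SetModel

universe u

/-- The relation symbols of the language of set theory: one binary symbol. -/
inductive SetRel : ℕ → Type
  | mem : SetRel 2

/-- The first-order language of set theory `{∈}`. -/
def setLang : FirstOrder.Language.{0, 0} where
  Functions := fun _ => Empty
  Relations := SetRel

/-- The membership relation of a structure for the language of set theory. -/
def Mem {M : Type u} [setLang.Structure M] (x y : M) : Prop :=
  FirstOrder.Language.Structure.RelMap (L := setLang) SetRel.mem ![x, y]

infix:50 " ∈ᴹ " => SetModel.Mem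

section Notions

variable {M : Type u} [setLang.Structure M]

/-- `x ⊆ y`. -/
def IsSubset (x y : M) : Prop := ∀ z : M, z ∈ᴹ x → z ∈ᴹ y

/-- `x = ∅`. -/
def IsEmptySet (x : M) : Prop := ∀ z : M, ¬ z ∈ᴹ x

/-- `p = {x, y}`. -/
def IsUnorderedPair (p x y : M) : Prop := ∀ z : M, z ∈ᴹ p ↔ z = x ∨ z = y

/-- `p = (x, y) = {{x}, {x, y}}`. -/
def IsOrderedPair (p x y : M) : Prop :=
  ∃ a b : M, IsUnorderedPair a x x ∧ IsUnorderedPair b x y ∧ IsUnorderedPair p a b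

/-- `u = ⋃ x`. -/
def IsUnion (u x : M) : Prop := ∀ z : M, z ∈ᴹ u ↔ ∃ y : M, y ∈ᴹ x ∧ z ∈ᴹ y

/-- `s = x ∪ {x}`. -/
def IsSucc (s x : M) : Prop := ∀ z : M, z ∈ᴹ s ↔ z ∈ᴹ x ∨ z = x

/-- `I` contains `∅` and is closed under `x ↦ x ∪ {x}`. -/
def IsInductive (I : M) : Prop :=
  (∃ e : M, IsEmptySet e ∧ e ∈ᴹ I) ∧ ∀ x : M, x ∈ᴹ I → ∃ s : M, IsSucc s x ∧ s ∈ᴹ I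

/-- `n` is a natural number (a finite von Neumann ordinal) in the sense of the model:
it belongs to every inductive set. -/
def IsNatural (n : M) : Prop := ∀ I : M, IsInductive I → n ∈ᴹ I

/-- `w = ω`, the set of all natural numbers. -/
def IsOmega (w : M) : Prop := ∀ n : M, n ∈ᴹ w ↔ IsNatural n

/-- `t = 2 = {∅, {∅}}`. -/
def IsTwo (t : M) : Prop := ∃ e o : M, IsEmptySet e ∧ IsSucc o e ∧ IsSucc t o

/-- `(x, y) ∈ f`, that is, `f(x) = y` when `f` is a function. -/
def Maps (f x y : M) : Prop := ∃ p : M, IsOrderedPair p x y ∧ p ∈ᴹ f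

/-- `f` is a function from `A` to `B` (as a set of ordered pairs). -/
def IsFunction (f A B : M) : Prop :=
  (∀ p : M, p ∈ᴹ f → ∃ x y : M, x ∈ᴹ A ∧ y ∈ᴹ B ∧ IsOrderedPair p x y) ∧
    ∀ x : M, x ∈ᴹ A → ∃! y : M, Maps f x y

/-- `f` is an injective function from `A` to `B`. -/
def IsInjection (f A B : M) : Prop :=
  IsFunction f A B ∧ ∀ x x' y : M, Maps f x y → Maps f x' y → x = x'

/-- `f` is a bijection from `A` onto `B`. -/
def IsBijection (f A B : M) : Prop :=
  IsInjection f A B ∧ ∀ y : M, y ∈ᴹ B → ∃ x : M, Maps f x y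

/-- `X` is finite: it is in bijection with a natural number. -/
def IsFinite (X : M) : Prop := ∃ n f : M, IsNatural n ∧ IsBijection f X n

/-- `X` is infinite: it is not finite. -/
def IsInfinite (X : M) : Prop := ¬ IsFinite X

/-- `X` is Dedekind-infinite: `ω` injects into `X`. -/
def IsDedekindInfinite (X : M) : Prop := ∃ w f : M, IsOmega w ∧ IsInjection f w X

/-- `X` is countable: it injects into `ω`. -/
def IsCountable (X : M) : Prop := ∃ w f : M, IsOmega w ∧ IsInjection f X w

/-- `P = [X]^{<ω}`, the set of all finite subsets of `X`. -/
def IsFinitePowerset (P X : M) : Prop := ∀ F : M, F ∈ᴹ P ↔ IsSubset F X ∧ IsFinite F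

/-- `Q = [X]²`, the set of all two-element subsets of `X`. -/
def IsPairSet (Q X : M) : Prop :=
  ∀ s : M, s ∈ᴹ Q ↔ ∃ x y : M, x ∈ᴹ X ∧ y ∈ᴹ X ∧ x ≠ y ∧ IsUnorderedPair s x y

/-- Distinct members of `Y` are disjoint. -/
def IsPairwiseDisjoint (Y : M) : Prop :=
  ∀ a b : M, a ∈ᴹ Y → b ∈ᴹ Y → a ≠ b → ∀ z : M, ¬ (z ∈ᴹ a ∧ z ∈ᴹ b)

/-- `U = FU(Y)`, the set of all unions of nonempty finite subsets of `Y`. -/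
def IsFiniteUnions (U Y : M) : Prop :=
  ∀ u : M, u ∈ᴹ U ↔
    ∃ F : M, IsSubset F Y ∧ IsFinite F ∧ ¬ IsEmptySet F ∧ IsUnion u F

/-- The set `S` is `c`-monochromatic: `c` is defined on all of `S`, with one constant value. -/
def IsMonochromatic (c S : M) : Prop := ∃ i : M, ∀ s : M, s ∈ᴹ S → Maps c s i

end Notions

/-- The valuation `x, v 0, v 1, …` of the variables `0, 1, 2, …`. -/
def vcons {M : Type u} (x : M) (v : ℕ → M) : ℕ → M
  | 0 => x
  | k + 1 => v k

/-- `M` is a model of ZF.  In the two schemas `φ` runs over all first-order formulas of the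
language of set theory, and `v` assigns the parameters. -/
structure IsModelOfZF (M : Type u) [setLang.Structure M] : Prop where
  extensionality : ∀ x y : M, (∀ z : M, z ∈ᴹ x ↔ z ∈ᴹ y) → x = y
  foundation : ∀ x : M, ¬ IsEmptySet x → ∃ y : M, y ∈ᴹ x ∧ ∀ z : M, ¬ (z ∈ᴹ x ∧ z ∈ᴹ y)
  pairing : ∀ x y : M, ∃ p : M, IsUnorderedPair p x y
  union : ∀ x : M, ∃ u : M, IsUnion u x
  powerset : ∀ x : M, ∃ p : M, ∀ z : M, z ∈ᴹ p ↔ IsSubset z x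
  infinity : ∃ I : M, IsInductive I
  separation : ∀ (φ : setLang.Formula ℕ) (v : ℕ → M) (a : M),
    ∃ b : M, ∀ x : M, x ∈ᴹ b ↔ x ∈ᴹ a ∧ φ.Realize (vcons x v)
  replacement : ∀ (φ : setLang.Formula ℕ) (v : ℕ → M) (a : M),
    (∀ x y y' : M, x ∈ᴹ a → φ.Realize (vcons x (vcons y v)) →
      φ.Realize (vcons x (vcons y' v)) → y = y') →
    ∃ b : M, ∀ y : M, y ∈ᴹ b ↔ ∃ x : M, x ∈ᴹ a ∧ φ.Realize (vcons x (vcons y v))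

section Principles

variable (M : Type u) [setLang.Structure M]

/-- Fin = D-Fin, in `M`: every infinite set is Dedekind-infinite. -/
def FinEqDFin : Prop := ∀ X : M, IsInfinite X → IsDedekindInfinite X

/-- Ramsey's theorem RT, in `M`: for every infinite `X` and every `c : [X]² → 2` there is
an infinite `Y ⊆ X` such that `[Y]²` is `c`-monochromatic. -/
def RT : Prop :=
  ∀ X : M, IsInfinite X → ∀ Q t c : M, IsPairSet Q X → IsTwo t → IsFunction c Q t →
    ∃ Y R : M, IsSubset Y X ∧ IsInfinite Y ∧ IsPairSet R Y ∧ IsMonochromatic c R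

/-- König's lemma KL, in `M`: every countable family of nonempty finite sets
admits a choice function. -/
def KL : Prop :=
  ∀ A : M, IsCountable A → (∀ a : M, a ∈ᴹ A → ¬ IsEmptySet a ∧ IsFinite a) →
    ∃ U f : M, IsUnion U A ∧ IsFunction f A U ∧ ∀ a y : M, Maps f a y → y ∈ᴹ a

/-- Hindman's theorem HT, in `M`: for every infinite `X` and every `c : [X]^{<ω} → 2` there is
an infinite, pairwise disjoint `Y ⊆ [X]^{<ω}` such that `FU(Y)` is `c`-monochromatic. -/
def HT : Prop :=
  ∀ X : M, IsInfinite X → ∀ P t c : M, IsFinitePowerset P X → IsTwo t → IsFunction c P t →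
    ∃ Y U : M, IsSubset Y P ∧ IsInfinite Y ∧ IsPairwiseDisjoint Y ∧
      IsFiniteUnions U Y ∧ IsMonochromatic c U

end Principles

end SetModel

/-! Everything happens inside the model `M`. Separation and Replacement are schemas over formulas,
so every set that is formed needs a definability proof; the classes `DefP` and `DefF` let instance
search supply these, and after that the arguments are ordinary ZF mathematics.

From (1) to (2): an infinite set contains an infinite set `W` that injects into `ω`. Both `W` and
`[W]^{<ω}` then have choice functions on their nonempty subsets, the second one because finite sets
of naturals can be well-ordered explicitly. The usual countable proofs of Ramsey and Hindman can be
run on `W`. Each is a sequence of applications of `exists_infinite_of_extension`, which replaces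
dependent choice: only elements of a choosable set are ever chosen, while the infinite reservoirs or
subfamilies that keep the construction alive occur existentially in the definition of the family
being extended. Ramsey is `exists_homogeneous`. Hindman follows Baumgartner's largeness argument:
`X` is large for a family closed under disjoint unions if it meets every such subfamily; largeness
survives finite partitions (`large_un`), can be shifted by some finite set (`Large.exists_shift`)
and then by a member of `X` (`Large.exists_shift_mem`), and iteration gives
`Large.exists_FU_subset`.

From (2) to (3), `kl_of_rt`: Ramsey is applied to the set of pairs `(n, g)` with `g` a choice
function on the first `n` positions of the countable family, two pairs being coloured by whether
their first components agree. A fixed `n` has only finitely many `g`, so a homogeneous set has one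
`g` for each of infinitely many `n`, and these combine into a full choice function.

From (3) to (1), `finEqDFin_of_kl_ht`: a finite set is coloured by the parity of the exponent of 2
in its cardinality. Two disjoint members of equal nonzero cardinality `n` would have a union of
cardinality `2n` and of the other colour. Hence in a Hindman family the cardinality is injective,
the family is countable, and König's lemma picks a point in each nonempty member; by disjointness
these points are distinct and yield an injection of `ω`. -/

namespace SetModel

open FirstOrder FirstOrder.Language

universe u

set_option linter.unusedSectionVars false

/-! ### Definability with parameters, and the axiom schemas in usable form -/

section Definability

variable {M : Type u} [setLang.Structure M]

/-- The valuation with its first value dropped. -/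
def tail (w : ℕ → M) : ℕ → M := fun k => w (k + 1)

/-- Predicates on valuations that are first-order definable with parameters. -/
class DefP (P : (ℕ → M) → Prop) : Prop where
  out : ∃ (p : ℕ → M) (φ : setLang.Formula (ℕ ⊕ ℕ)), ∀ v, φ.Realize (Sum.elim p v) ↔ P v

/-- Functions of valuations whose graph is definable with parameters. -/
class DefF (f : (ℕ → M) → M) : Prop where
  out : DefP (fun w => w 0 = f (tail w))

/-- Iterated tails of the valuation. -/
class IsTail (f : (ℕ → M) → (ℕ → M)) : Prop where
  out : ∃ n, ∀ w k, f w k = w (k + n)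

instance isTail_id : IsTail (fun w : ℕ → M => w) := ⟨0, fun _ _ => rfl⟩

instance isTail_tail : IsTail (tail : (ℕ → M) → (ℕ → M)) := ⟨1, fun _ _ => rfl⟩

instance isTail_tail_comp (f : (ℕ → M) → (ℕ → M)) [h : IsTail f] :
    IsTail (fun w => tail (f w)) := by
  obtain ⟨n, hn⟩ := h.out
  exact ⟨n + 1, fun w k => by simp only [tail, hn]; congr 1; omega⟩

theorem DefP.congr {P Q : (ℕ → M) → Prop} (hP : DefP P) (h : ∀ v, P v ↔ Q v) : DefP Q := by
  obtain ⟨p, φ, hφ⟩ := hP.out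
  exact ⟨p, φ, fun v => (hφ v).trans (h v)⟩

theorem DefP.rename {P : (ℕ → M) → Prop} (hP : DefP P) (σ : ℕ → ℕ) :
    DefP (fun w => P (fun k => w (σ k))) := by
  obtain ⟨p, φ, hφ⟩ := hP.out
  refine ⟨p, φ.relabel (Sum.map id σ), fun v => ?_⟩
  rw [Formula.realize_relabel, ← hφ]
  have : Sum.elim p v ∘ Sum.map id σ = Sum.elim p (fun k => v (σ k)) := by
    ext (k | k) <;> rfl
  rw [this]

/-- The renaming of variables that fixes the first one and shifts the others. -/
def headShift (n : ℕ) : ℕ → ℕ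
  | 0 => 0
  | k + 1 => k + n

instance DefP.not (P : (ℕ → M) → Prop) [hP : DefP P] : DefP (fun w => ¬ P w) := by
  obtain ⟨p, φ, hφ⟩ := hP.out
  exact ⟨p, φ.not, fun v => by rw [Formula.realize_not, hφ]⟩

instance DefP.and (P Q : (ℕ → M) → Prop) [hP : DefP P] [hQ : DefP Q] :
    DefP (fun w => P w ∧ Q w) := by
  obtain ⟨p, φ, hφ⟩ := hP.out
  obtain ⟨q, ψ, hψ⟩ := hQ.out
  -- The two formulas come with separate parameter lists; placing them at even and odd indices
  -- merges them into one.
  refine ⟨fun k => if k % 2 = 0 then p (k / 2) else q (k / 2),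
    φ.relabel (Sum.map (fun k => 2 * k) id) ⊓ ψ.relabel (Sum.map (fun k => 2 * k + 1) id),
    fun v => ?_⟩
  rw [Formula.realize_inf, Formula.realize_relabel, Formula.realize_relabel, ← hφ, ← hψ]
  have h1 : Sum.elim (fun k => if k % 2 = 0 then p (k / 2) else q (k / 2)) v ∘
      Sum.map (fun k => 2 * k) id = Sum.elim p v := by
    ext (k | k) <;> simp
  have h2 : Sum.elim (fun k => if k % 2 = 0 then p (k / 2) else q (k / 2)) v ∘
      Sum.map (fun k => 2 * k + 1) id = Sum.elim q v := by
    ext (k | k)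
    · simp only [Function.comp, Sum.map_inl, Sum.elim_inl]
      rw [if_neg (by omega)]
      congr 1
      omega
    · rfl
  rw [h1, h2]

instance DefP.or (P Q : (ℕ → M) → Prop) [DefP P] [DefP Q] : DefP (fun w => P w ∨ Q w) :=
  DefP.congr (P := fun w => ¬ (¬ P w ∧ ¬ Q w)) inferInstance (fun v => by tauto)

instance DefP.imp (P Q : (ℕ → M) → Prop) [DefP P] [DefP Q] : DefP (fun w => P w → Q w) :=
  DefP.congr (P := fun w => ¬ (P w ∧ ¬ Q w)) inferInstance (fun v => by tauto)

instance DefP.iff (P Q : (ℕ → M) → Prop) [DefP P] [DefP Q] : DefP (fun w => P w ↔ Q w) :=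
  DefP.congr (P := fun w => (P w → Q w) ∧ (Q w → P w)) inferInstance (fun v => by tauto)

/-- De Bruijn convention: the body reads the bound variable as `w 0` and the outer valuation as
`tail w`. This shape is what lets instance search descend through quantifiers written in ordinary
Lean syntax. -/
instance DefP.exists (P : (ℕ → M) → M → Prop) [hP : DefP (fun w => P (tail w) (w 0))] :
    DefP (fun w => ∃ x, P w x) := by
  obtain ⟨p, φ, hφ⟩ := hP.out
  let g : ℕ ⊕ ℕ → (ℕ ⊕ ℕ) ⊕ Unit
    | Sum.inl k => Sum.inl (Sum.inl k)
    | Sum.inr 0 => Sum.inr ()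
    | Sum.inr (k + 1) => Sum.inl (Sum.inr k)
  refine ⟨p, Formula.iExs Unit (φ.relabel g), fun v => ?_⟩
  rw [Formula.realize_iExs]
  have key : ∀ i : Unit → M, (φ.relabel g).Realize (Sum.elim (Sum.elim p v) i) ↔ P v (i ()) := by
    intro i
    rw [Formula.realize_relabel]
    have : Sum.elim (Sum.elim p v) i ∘ g = Sum.elim p (fun k => Nat.casesOn k (i ()) v) := by
      ext (k | (_ | k)) <;> rfl
    rw [this, hφ]
    rfl
  constructor
  · rintro ⟨i, hi⟩
    exact ⟨i (), (key i).1 hi⟩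
  · rintro ⟨x, hx⟩
    exact ⟨fun _ => x, (key _).2 hx⟩

instance DefP.forall (P : (ℕ → M) → M → Prop) [hP : DefP (fun w => P (tail w) (w 0))] :
    DefP (fun w => ∀ x, P w x) :=
  DefP.congr (P := fun w => ¬ ∃ x, ¬ P w x) inferInstance (fun v => by simp)

theorem DefF.comp_tail {f : (ℕ → M) → M} (hf : DefF f) : DefF (fun w => f (tail w)) :=
  ⟨hf.out.rename (headShift 2)⟩

theorem DefP.comp_tail {P : (ℕ → M) → Prop} (hP : DefP P) : DefP (fun w => P (tail w)) :=
  hP.rename (fun k => k + 1)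

/-- The valuation with a new first value. -/
def scons (x : M) (w : ℕ → M) : ℕ → M := fun k => Nat.casesOn k x w

theorem scons_head_tail (w : ℕ → M) : scons (w 0) (tail w) = w := by
  ext (_ | k) <;> rfl

/-- Models of ZF, as a class. -/
class ZF (M : Type u) [setLang.Structure M] : Prop where
  out : IsModelOfZF M

variable [hM : ZF M]

instance : Nonempty M := ⟨hM.out.infinity.choose⟩

theorem DefP.eq_var (i j : ℕ) : DefP (fun w : ℕ → M => w i = w j) :=
  ⟨fun _ => Classical.arbitrary M, Term.equal (Term.var (Sum.inr i)) (Term.var (Sum.inr j)),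
    fun v => by simp [Formula.realize_equal]⟩

theorem DefP.mem_var (i j : ℕ) : DefP (fun w : ℕ → M => w i ∈ᴹ w j) :=
  ⟨fun _ => Classical.arbitrary M,
    Relations.formula₂ (L := setLang) (SetRel.mem : setLang.Relations 2)
      (Term.var (Sum.inr i : ℕ ⊕ ℕ)) (Term.var (Sum.inr j)),
    fun _ => Formula.realize_rel₂ (L := setLang)⟩

instance DefF.const (a : M) : DefF (fun _ : ℕ → M => a) :=
  ⟨⟨fun _ => a, Term.equal (Term.var (Sum.inr 0)) (Term.var (Sum.inl 0)),
    fun v => by simp [Formula.realize_equal]⟩⟩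

instance DefF.var (f : (ℕ → M) → (ℕ → M)) [hf : IsTail f] (k : ℕ) : DefF (fun w => f w k) := by
  obtain ⟨n, hn⟩ := hf.out
  exact ⟨(DefP.eq_var 0 (k + n + 1)).congr fun v => by rw [hn]; rfl⟩

/-- The language has no function symbols, so substituting a definable operation means quantifying
over its value: `∃ x, x = f w ∧ P x`. -/
theorem DefP.subst {P : (ℕ → M) → Prop} (hP : DefP P) {f : (ℕ → M) → M} (hf : DefF f) :
    DefP (fun w => P (scons (f w) w)) := by
  have h1 := hf.out
  have h2 : DefP (fun w => P (scons (w 0) (tail w))) := hP.congr fun w => by rw [scons_head_tail]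
  have h3 : DefP (fun w => ∃ x, x = f w ∧ P (scons x w)) := inferInstance
  exact h3.congr fun w => by simp

theorem DefP.comp₁ {R : M → Prop} (hR : DefP (fun w => R (w 0))) (f : (ℕ → M) → M) [hf : DefF f] :
    DefP (fun w => R (f w)) :=
  hR.subst hf

theorem DefP.comp₂ {R : M → M → Prop} (hR : DefP (fun w => R (w 0) (w 1)))
    (f g : (ℕ → M) → M) [hf : DefF f] [hg : DefF g] : DefP (fun w => R (f w) (g w)) :=
  (hR.subst hf.comp_tail).subst hg

theorem DefP.comp₃ {R : M → M → M → Prop} (hR : DefP (fun w => R (w 0) (w 1) (w 2)))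
    (f g h : (ℕ → M) → M) [hf : DefF f] [hg : DefF g] [hh : DefF h] :
    DefP (fun w => R (f w) (g w) (h w)) :=
  ((hR.subst hf.comp_tail.comp_tail).subst hg.comp_tail).subst hh

theorem DefP.comp₄ {R : M → M → M → M → Prop} (hR : DefP (fun w => R (w 0) (w 1) (w 2) (w 3)))
    (f g h i : (ℕ → M) → M) [hf : DefF f] [hg : DefF g] [hh : DefF h] [hi : DefF i] :
    DefP (fun w => R (f w) (g w) (h w) (i w)) :=
  (((hR.subst hf.comp_tail.comp_tail.comp_tail).subst hg.comp_tail.comp_tail).subst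
    hh.comp_tail).subst hi

theorem DefF.comp₁ {F : M → M} (hF : DefF (fun w => F (w 0))) (f : (ℕ → M) → M) [hf : DefF f] :
    DefF (fun w => F (f w)) :=
  ⟨DefP.comp₂ (R := fun x y => x = F y) hF.out (fun w => w 0) (fun w => f (tail w))
    (hg := hf.comp_tail)⟩

theorem DefF.comp₂ {F : M → M → M} (hF : DefF (fun w => F (w 0) (w 1)))
    (f g : (ℕ → M) → M) [hf : DefF f] [hg : DefF g] : DefF (fun w => F (f w) (g w)) :=
  ⟨DefP.comp₃ (R := fun x y z => x = F y z) hF.out (fun w => w 0) (fun w => f (tail w))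
    (fun w => g (tail w)) (hg := hf.comp_tail) (hh := hg.comp_tail)⟩

theorem DefF.comp₃ {F : M → M → M → M} (hF : DefF (fun w => F (w 0) (w 1) (w 2)))
    (f g h : (ℕ → M) → M) [hf : DefF f] [hg : DefF g] [hh : DefF h] :
    DefF (fun w => F (f w) (g w) (h w)) :=
  ⟨DefP.comp₄ (R := fun x y z t => x = F y z t) hF.out (fun w => w 0) (fun w => f (tail w))
    (fun w => g (tail w)) (fun w => h (tail w)) (hg := hf.comp_tail) (hh := hg.comp_tail)
    (hi := hh.comp_tail)⟩

instance DefP.eq (f g : (ℕ → M) → M) [DefF f] [DefF g] : DefP (fun w => f w = g w) :=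
  DefP.comp₂ (R := fun x y => x = y) (DefP.eq_var 0 1) f g

instance DefP.ne (f g : (ℕ → M) → M) [DefF f] [DefF g] : DefP (fun w => f w ≠ g w) :=
  inferInstanceAs (DefP (fun w => ¬ f w = g w))

instance DefP.mem (f g : (ℕ → M) → M) [DefF f] [DefF g] : DefP (fun w => f w ∈ᴹ g w) :=
  DefP.comp₂ (R := fun x y => x ∈ᴹ y) (DefP.mem_var 0 1) f g

instance DefP.true : DefP (fun _ : ℕ → M => True) :=
  (DefP.eq_var 0 0).congr fun v => by simp

instance DefP.false : DefP (fun _ : ℕ → M => False) :=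
  (DefP.not (fun _ => True)).congr fun v => by simp

instance DefP.existsUnique (P : (ℕ → M) → M → Prop) [hP : DefP (fun w => P (tail w) (w 0))] :
    DefP (fun w => ∃! x, P w x) := by
  have h : DefP (fun w => P (tail (tail w)) (w 0)) :=
    DefP.rename (P := fun w => P (tail w) (w 0)) hP
      (headShift 2)
  exact inferInstanceAs (DefP (fun w => ∃ x, P w x ∧ ∀ y, P w y → y = x))

open Classical in
instance DefF.ite (P : (ℕ → M) → Prop) (f g : (ℕ → M) → M) [hP : DefP P] [hf : DefF f]
    [hg : DefF g] : DefF (fun w => if P w then f w else g w) := by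
  have h1 := hf.out
  have h2 := hg.out
  have h3 := hP.comp_tail
  have h4 : DefP (fun w => (P (tail w) ∧ w 0 = f (tail w)) ∨ (¬ P (tail w) ∧ w 0 = g (tail w))) :=
    inferInstance
  exact ⟨h4.congr fun w => by by_cases h : P (tail w) <;> simp [h]⟩

/-! ### The axioms, for definable predicates -/

theorem ext {x y : M} (h : ∀ z, z ∈ᴹ x ↔ z ∈ᴹ y) : x = y := hM.out.extensionality x y h

theorem exists_sep (a : M) (P : M → Prop) [hP : DefP (fun w => P (w 0))] :
    ∃ b, ∀ x, x ∈ᴹ b ↔ x ∈ᴹ a ∧ P x := by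
  obtain ⟨p, φ, hφ⟩ := hP.out
  -- The schema reserves variable 0 for the element, so parameters move up by one. Since `P` looks
  -- only at `w 0`, all object variables may be sent to 0.
  obtain ⟨b, hb⟩ := hM.out.separation
    (φ.relabel (Sum.elim (fun k => k + 1) (fun _ => 0))) p a
  refine ⟨b, fun x => ?_⟩
  rw [hb, Formula.realize_relabel, ← hφ (fun _ => x)]
  have : vcons x p ∘ Sum.elim (fun k => k + 1) (fun _ : ℕ => 0) = Sum.elim p (fun _ => x) := by
    ext (k | k) <;> rfl
  rw [this]

theorem exists_img (a : M) (F : M → M) [hF : DefF (fun w => F (w 0))] :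
    ∃ b, ∀ y, y ∈ᴹ b ↔ ∃ x, x ∈ᴹ a ∧ y = F x := by
  obtain ⟨p, φ, hφ⟩ := hF.out.out
  have key : ∀ x y, (φ.relabel (Sum.elim (fun k => k + 2)
      (fun k => Nat.casesOn k 1 (fun _ => 0)))).Realize (vcons x (vcons y p)) ↔ y = F x := by
    intro x y
    rw [Formula.realize_relabel]
    have : vcons x (vcons y p) ∘ Sum.elim (fun k => k + 2) (fun k => Nat.casesOn k 1 (fun _ => 0))
        = Sum.elim p (scons y (fun _ => x)) := by
      ext (k | (_ | k)) <;> rfl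
    rw [this, hφ]
    rfl
  obtain ⟨b, hb⟩ := hM.out.replacement _ p a (fun x y y' _ h h' => by
    rw [key] at h h'
    rw [h, h'])
  exact ⟨b, fun y => by rw [hb]; simp only [key]⟩

end Definability

/-! ### Set-theoretic operations as definable terms -/

section SetOperations

variable {M : Type u} [setLang.Structure M] [hM : ZF M]

open Classical in
/-- The set `{x | P x}`, with a default value if there is no such set. -/
noncomputable def cls (P : M → Prop) : M :=
  if h : ∃ b, ∀ x, x ∈ᴹ b ↔ P x then h.choose else Classical.arbitrary M

theorem mem_cls {P : M → Prop} (h : ∃ b, ∀ x, x ∈ᴹ b ↔ P x) (x : M) : x ∈ᴹ cls P ↔ P x := by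
  rw [cls, dif_pos h]
  exact h.choose_spec x

/-- The default value does not spoil definability: the graph says that `w 0` has exactly the
prescribed members, or that no such set exists and `w 0` is the default. So every term built from
`cls` is admissible in the schemas before its existence is proved. -/
instance DefF.cls (P : (ℕ → M) → M → Prop) [hP : DefP (fun w => P (tail w) (w 0))] :
    DefF (fun w => cls (P w)) := by
  have h1 : DefP (fun w => P (tail (tail w)) (w 0)) :=
    DefP.rename (P := fun w => P (tail w) (w 0)) hP
      (headShift 2)
  have h2 : DefP (fun w => P (tail (tail (tail w))) (w 0)) :=
    DefP.rename (P := fun w => P (tail w) (w 0)) hP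
      (headShift 3)
  have h3 : DefP (fun w => (∀ x, x ∈ᴹ w 0 ↔ P (tail w) x) ∨
      (¬ (∃ b, ∀ x, x ∈ᴹ b ↔ P (tail w) x) ∧ w 0 = Classical.arbitrary M)) := inferInstance
  refine ⟨h3.congr fun w => ?_⟩
  by_cases h : ∃ b, ∀ x, x ∈ᴹ b ↔ P (tail w) x
  · simp only [h, not_true, false_and, or_false]
    constructor
    · intro h'
      exact ext fun x => by rw [h', mem_cls h]
    · intro h' x
      rw [h', mem_cls h]
  · have : ¬ ∀ x, x ∈ᴹ w 0 ↔ P (tail w) x := fun h' => h ⟨_, h'⟩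
    simp only [this, h, not_false_iff, true_and, false_or]
    rw [SetModel.cls, dif_neg h]

/-- `{x ∈ a | P x}` -/
noncomputable def sep (a : M) (P : M → Prop) : M := cls fun x => x ∈ᴹ a ∧ P x

/-- `{F x | x ∈ a}` -/
noncomputable def img (a : M) (F : M → M) : M := cls fun y => ∃ x, x ∈ᴹ a ∧ y = F x

theorem mem_sep {a : M} {P : M → Prop} [DefP (fun w => P (w 0))] {x : M} :
    x ∈ᴹ sep a P ↔ x ∈ᴹ a ∧ P x := mem_cls (exists_sep a P) x

theorem mem_img {a : M} {F : M → M} [DefF (fun w => F (w 0))] {y : M} :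
    y ∈ᴹ img a F ↔ ∃ x, x ∈ᴹ a ∧ y = F x := mem_cls (exists_img a F) y

instance DefF.sep (a : (ℕ → M) → M) (P : (ℕ → M) → M → Prop) [ha : DefF a]
    [hP : DefP (fun w => P (tail w) (w 0))] : DefF (fun w => sep (a w) (P w)) := by
  have := ha.comp_tail
  exact DefF.cls (fun w x => x ∈ᴹ a w ∧ P w x)

instance DefF.img (a : (ℕ → M) → M) (F : (ℕ → M) → M → M) [ha : DefF a]
    [hF : DefF (fun w => F (tail w) (w 0))] : DefF (fun w => img (a w) (F w)) := by
  have h1 := ha.comp_tail.comp_tail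
  have h2 : DefP (fun w : ℕ → M => tail w 0 = F (tail (tail w)) (w 0)) :=
    DefP.rename hF.out fun
      | 0 => 1
      | 1 => 0
      | k + 2 => k + 2
  have h3 : DefP (fun w => ∃ x, x ∈ᴹ a (tail w) ∧ w 0 = F (tail w) x) := inferInstance
  exact DefF.cls (fun w y => ∃ x, x ∈ᴹ a w ∧ y = F w x)

instance DefP.isSubset (f g : (ℕ → M) → M) [DefF f] [DefF g] :
    DefP (fun w => IsSubset (f w) (g w)) :=
  DefP.comp₂ (R := IsSubset) (by unfold IsSubset; infer_instance) f g

theorem exists_emp : ∃ b : M, ∀ x, x ∈ᴹ b ↔ False := by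
  obtain ⟨b, hb⟩ := exists_sep (Classical.arbitrary M) (fun _ => False)
  exact ⟨b, fun x => by rw [hb]; simp⟩

/-- The empty set. -/
noncomputable def emp : M := cls fun _ => False

@[simp] theorem mem_emp {x : M} : ¬ x ∈ᴹ emp := fun h => (mem_cls exists_emp x).1 h

/-- `{x, y}` -/
noncomputable def upair (x y : M) : M := cls fun z => z = x ∨ z = y

@[simp] theorem mem_upair {x y z : M} : z ∈ᴹ upair x y ↔ z = x ∨ z = y :=
  mem_cls (hM.out.pairing x y) z

instance DefF.upair (f g : (ℕ → M) → M) [DefF f] [DefF g] : DefF (fun w => upair (f w) (g w)) :=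
  DefF.comp₂ (F := SetModel.upair) (by unfold SetModel.upair; infer_instance) f g

/-- `⋃ x` -/
noncomputable def sUnion (x : M) : M := cls fun z => ∃ y, y ∈ᴹ x ∧ z ∈ᴹ y

@[simp] theorem mem_sUnion {x z : M} : z ∈ᴹ sUnion x ↔ ∃ y, y ∈ᴹ x ∧ z ∈ᴹ y :=
  mem_cls (hM.out.union x) z

instance DefF.sUnion (f : (ℕ → M) → M) [DefF f] : DefF (fun w => sUnion (f w)) :=
  DefF.comp₁ (F := SetModel.sUnion) (by unfold SetModel.sUnion; infer_instance) f

/-- The power set. -/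
noncomputable def pow (x : M) : M := cls fun z => IsSubset z x

@[simp] theorem mem_pow {x z : M} : z ∈ᴹ pow x ↔ IsSubset z x :=
  mem_cls (hM.out.powerset x) z

instance DefF.pow (f : (ℕ → M) → M) [DefF f] : DefF (fun w => pow (f w)) :=
  DefF.comp₁ (F := SetModel.pow) (by unfold SetModel.pow; infer_instance) f

/-- `x ∪ y` -/
noncomputable def un (x y : M) : M := sUnion (upair x y)

@[simp] theorem mem_un {x y z : M} : z ∈ᴹ un x y ↔ z ∈ᴹ x ∨ z ∈ᴹ y := by
  simp [un, or_and_right, exists_or]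

instance DefF.un (f g : (ℕ → M) → M) [DefF f] [DefF g] : DefF (fun w => un (f w) (g w)) :=
  DefF.comp₂ (F := SetModel.un) (by unfold SetModel.un; infer_instance) f g

/-- `{x}` -/
noncomputable def sing (x : M) : M := upair x x

@[simp] theorem mem_sing {x z : M} : z ∈ᴹ sing x ↔ z = x := by simp [sing]

instance DefF.sing (f : (ℕ → M) → M) [DefF f] : DefF (fun w => sing (f w)) :=
  DefF.comp₁ (F := SetModel.sing) (by unfold SetModel.sing; infer_instance) f

/-- `s ∪ {a}` -/
noncomputable def ins (a s : M) : M := un s (sing a)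

@[simp] theorem mem_ins {a s z : M} : z ∈ᴹ ins a s ↔ z ∈ᴹ s ∨ z = a := by simp [ins]

instance DefF.ins (f g : (ℕ → M) → M) [DefF f] [DefF g] : DefF (fun w => ins (f w) (g w)) :=
  DefF.comp₂ (F := SetModel.ins) (by unfold SetModel.ins; infer_instance) f g

/-- `x \ y` -/
noncomputable def diff (x y : M) : M := sep x fun z => ¬ z ∈ᴹ y

@[simp] theorem mem_diff {x y z : M} : z ∈ᴹ diff x y ↔ z ∈ᴹ x ∧ ¬ z ∈ᴹ y := mem_sep

instance DefF.diff (f g : (ℕ → M) → M) [DefF f] [DefF g] : DefF (fun w => diff (f w) (g w)) :=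
  DefF.comp₂ (F := SetModel.diff) (by unfold SetModel.diff; infer_instance) f g

/-- The Kuratowski pair. -/
noncomputable def opair (x y : M) : M := upair (sing x) (upair x y)

instance DefF.opair (f g : (ℕ → M) → M) [DefF f] [DefF g] : DefF (fun w => opair (f w) (g w)) :=
  DefF.comp₂ (F := SetModel.opair) (by unfold SetModel.opair; infer_instance) f g

theorem isUnorderedPair_iff {p x y : M} : IsUnorderedPair p x y ↔ p = upair x y :=
  ⟨fun h => ext fun z => by rw [h z, mem_upair], fun h z => by rw [h, mem_upair]⟩

theorem isOrderedPair_iff {p x y : M} : IsOrderedPair p x y ↔ p = opair x y := by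
  simp [IsOrderedPair, isUnorderedPair_iff, opair, sing]

theorem upair_eq_sing {x y z : M} : upair x y = sing z ↔ x = z ∧ y = z := by
  constructor
  · intro h
    have h1 : x ∈ᴹ sing z := by rw [← h]; simp
    have h2 : y ∈ᴹ sing z := by rw [← h]; simp
    simp only [mem_sing] at h1 h2
    exact ⟨h1, h2⟩
  · rintro ⟨rfl, rfl⟩
    rfl

theorem sing_inj {x y : M} : sing x = sing y ↔ x = y := by
  rw [sing, upair_eq_sing, and_self]

theorem upair_right_inj {x y z : M} (h : upair x y = upair x z) : y = z := by
  have h1 : y ∈ᴹ upair x z := by rw [← h]; simp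
  have h2 : z ∈ᴹ upair x y := by rw [h]; simp
  simp only [mem_upair] at h1 h2
  rcases h1 with rfl | rfl
  · rcases h2 with rfl | rfl <;> rfl
  · rfl

@[simp] theorem opair_inj {x y x' y' : M} : opair x y = opair x' y' ↔ x = x' ∧ y = y' := by
  constructor
  · intro h
    have hx : x = x' := by
      have h1 : sing x ∈ᴹ opair x' y' := by rw [← h]; simp [opair]
      simp only [opair, mem_upair, sing_inj] at h1
      rcases h1 with h1 | h1
      · exact h1
      · exact (upair_eq_sing.1 h1.symm).1.symm
    subst hx
    refine ⟨rfl, ?_⟩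
    exact upair_right_inj (upair_right_inj h)
  · rintro ⟨rfl, rfl⟩
    rfl

theorem maps_iff {f x y : M} : Maps f x y ↔ opair x y ∈ᴹ f := by
  simp [Maps, isOrderedPair_iff]

/-- `A × B` -/
noncomputable def prod (A B : M) : M := sUnion (img A fun x => img B fun y => opair x y)

theorem mem_prod {A B p : M} : p ∈ᴹ prod A B ↔ ∃ x y, x ∈ᴹ A ∧ y ∈ᴹ B ∧ p = opair x y := by
  simp only [prod, mem_sUnion, mem_img]
  constructor
  · rintro ⟨_, ⟨x, hx, rfl⟩, hp⟩
    rw [mem_img] at hp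
    obtain ⟨y, hy, rfl⟩ := hp
    exact ⟨x, y, hx, hy, rfl⟩
  · rintro ⟨x, y, hx, hy, rfl⟩
    exact ⟨_, ⟨x, hx, rfl⟩, mem_img.2 ⟨y, hy, rfl⟩⟩

instance DefF.prod (f g : (ℕ → M) → M) [DefF f] [DefF g] : DefF (fun w => prod (f w) (g w)) :=
  DefF.comp₂ (F := SetModel.prod) (by unfold SetModel.prod; infer_instance) f g

@[simp] theorem opair_mem_prod {A B x y : M} : opair x y ∈ᴹ prod A B ↔ x ∈ᴹ A ∧ y ∈ᴹ B := by
  rw [mem_prod]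
  constructor
  · rintro ⟨x', y', hx, hy, h⟩
    obtain ⟨rfl, rfl⟩ := opair_inj.1 h
    exact ⟨hx, hy⟩
  · rintro ⟨hx, hy⟩
    exact ⟨x, y, hx, hy, rfl⟩

theorem subset_antisymm {x y : M} (h : IsSubset x y) (h' : IsSubset y x) : x = y :=
  ext fun z => ⟨h z, h' z⟩

theorem subset_refl (x : M) : IsSubset x x := fun _ h => h

theorem IsSubset.trans {x y z : M} (h : IsSubset x y) (h' : IsSubset y z) : IsSubset x z :=
  fun _ ht => h' _ (h _ ht)

theorem isEmptySet_iff {x : M} : IsEmptySet x ↔ x = emp :=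
  ⟨fun h => ext fun z => ⟨fun hz => (h z hz).elim, fun hz => (mem_emp hz).elim⟩,
    fun h z => by rw [h]; exact mem_emp⟩

theorem ne_emp_iff {x : M} : x ≠ emp ↔ ∃ y, y ∈ᴹ x := by
  rw [Ne, ← isEmptySet_iff, IsEmptySet]
  push Not
  rfl

theorem isSucc_iff {s x : M} : IsSucc s x ↔ s = ins x x :=
  ⟨fun h => ext fun z => by rw [h z, mem_ins], fun h z => by rw [h, mem_ins]⟩

theorem isUnion_iff {u x : M} : IsUnion u x ↔ u = sUnion x :=
  ⟨fun h => ext fun z => by rw [h z, mem_sUnion], fun h z => by rw [h, mem_sUnion]⟩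

/-! ### Functions -/

/-- The value of the function `f` at `x`. -/
noncomputable def app (f x : M) : M :=
  sUnion (cls fun y => opair x y ∈ᴹ f ∧ ∀ z, opair x z ∈ᴹ f → z = y)

instance DefF.app (f g : (ℕ → M) → M) [DefF f] [DefF g] : DefF (fun w => app (f w) (g w)) :=
  DefF.comp₂ (F := SetModel.app) (by unfold SetModel.app; infer_instance) f g

theorem app_eq {f x y : M} (h : opair x y ∈ᴹ f) (h' : ∀ z, opair x z ∈ᴹ f → z = y) :
    app f x = y := by
  have key : ∀ z, z ∈ᴹ sing y ↔ opair x z ∈ᴹ f ∧ ∀ t, opair x t ∈ᴹ f → t = z := by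
    intro z
    rw [mem_sing]
    constructor
    · rintro rfl
      exact ⟨h, h'⟩
    · rintro ⟨hz, -⟩
      exact h' z hz
  have h1 := mem_cls ⟨sing y, key⟩
  apply ext
  intro z
  rw [app, mem_sUnion]
  constructor
  · rintro ⟨t, ht, hz⟩
    rwa [mem_sing.1 ((key t).2 ((h1 t).1 ht))] at hz
  · intro hz
    exact ⟨y, (h1 y).2 ⟨h, h'⟩, hz⟩

/-- The function `x ↦ F x` with domain `A`. -/
noncomputable def lam (A : M) (F : M → M) : M := img A fun x => opair x (F x)

theorem mem_lam {A x y : M} {F : M → M} [DefF (fun w => F (w 0))] :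
    opair x y ∈ᴹ lam A F ↔ x ∈ᴹ A ∧ y = F x := by
  rw [lam, mem_img]
  constructor
  · rintro ⟨x', hx', h⟩
    obtain ⟨rfl, rfl⟩ := opair_inj.1 h
    exact ⟨hx', rfl⟩
  · rintro ⟨hx, rfl⟩
    exact ⟨x, hx, rfl⟩

theorem app_lam {A x : M} {F : M → M} [DefF (fun w => F (w 0))] (hx : x ∈ᴹ A) :
    app (lam A F) x = F x :=
  app_eq (mem_lam.2 ⟨hx, rfl⟩) fun _ hz => (mem_lam.1 hz).2

theorem isFunction_lam {A B : M} {F : M → M} [DefF (fun w => F (w 0))]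
    (h : ∀ x, x ∈ᴹ A → F x ∈ᴹ B) : IsFunction (lam A F) A B := by
  refine ⟨fun p hp => ?_, fun x hx => ⟨F x, maps_iff.2 (mem_lam.2 ⟨hx, rfl⟩), fun y hy => ?_⟩⟩
  · obtain ⟨x, hx, rfl⟩ := mem_img.1 hp
    exact ⟨x, F x, hx, h x hx, isOrderedPair_iff.2 rfl⟩
  · exact (mem_lam.1 (maps_iff.1 hy)).2

theorem IsFunction.maps_app {f A B x : M} (hf : IsFunction f A B) (hx : x ∈ᴹ A) :
    opair x (app f x) ∈ᴹ f := by
  obtain ⟨y, hy, hy'⟩ := hf.2 x hx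
  rw [maps_iff] at hy
  rwa [app_eq hy fun z hz => hy' z (maps_iff.2 hz)]

theorem IsFunction.mem_iff {f A B x y : M} (hf : IsFunction f A B) :
    opair x y ∈ᴹ f ↔ x ∈ᴹ A ∧ y = app f x := by
  constructor
  · intro h
    obtain ⟨x', y', hx', -, h'⟩ := hf.1 _ h
    obtain ⟨rfl, rfl⟩ := opair_inj.1 (isOrderedPair_iff.1 h')
    exact ⟨hx', (hf.2 x hx').unique (maps_iff.2 h) (maps_iff.2 (hf.maps_app hx'))⟩
  · rintro ⟨hx, rfl⟩
    exact hf.maps_app hx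

theorem IsFunction.app_mem {f A B x : M} (hf : IsFunction f A B) (hx : x ∈ᴹ A) :
    app f x ∈ᴹ B := by
  obtain ⟨x', y', hx', hy, h⟩ := hf.1 _ (hf.maps_app hx)
  obtain ⟨rfl, rfl⟩ := opair_inj.1 (isOrderedPair_iff.1 h)
  exact hy

theorem IsInjection.app_inj {f A B x y : M} (hf : IsInjection f A B) (hx : x ∈ᴹ A) (hy : y ∈ᴹ A)
    (h : app f x = app f y) : x = y :=
  hf.2 x y (app f x) (maps_iff.2 (hf.1.maps_app hx))
    (by rw [h]; exact maps_iff.2 (hf.1.maps_app hy))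

theorem isInjection_lam {A B : M} {F : M → M} [DefF (fun w => F (w 0))]
    (h : ∀ x, x ∈ᴹ A → F x ∈ᴹ B) (h' : ∀ x y, x ∈ᴹ A → y ∈ᴹ A → F x = F y → x = y) :
    IsInjection (lam A F) A B := by
  refine ⟨isFunction_lam h, fun x x' y hx hx' => ?_⟩
  obtain ⟨h1, h2⟩ := mem_lam.1 (maps_iff.1 hx)
  obtain ⟨h3, h4⟩ := mem_lam.1 (maps_iff.1 hx')
  exact h' x x' h1 h3 (h2.symm.trans h4)

theorem isBijection_lam {A B : M} {F : M → M} [DefF (fun w => F (w 0))]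
    (h : ∀ x, x ∈ᴹ A → F x ∈ᴹ B) (h' : ∀ x y, x ∈ᴹ A → y ∈ᴹ A → F x = F y → x = y)
    (h'' : ∀ y, y ∈ᴹ B → ∃ x, x ∈ᴹ A ∧ F x = y) :
    IsBijection (lam A F) A B :=
  ⟨isInjection_lam h h', fun y hy => by
    obtain ⟨x, hx, rfl⟩ := h'' y hy
    exact ⟨x, maps_iff.2 (mem_lam.2 ⟨hx, rfl⟩)⟩⟩

theorem IsBijection.exists_app {f A B y : M} (hf : IsBijection f A B) (hy : y ∈ᴹ B) :
    ∃ x, x ∈ᴹ A ∧ app f x = y := by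
  obtain ⟨x, hx⟩ := hf.2 y hy
  have := hf.1.1.mem_iff.1 (maps_iff.1 hx)
  exact ⟨x, this.1, this.2.symm⟩

/-- The inverse image of `y` under the function `f` on `A`. -/
noncomputable def inv (A f y : M) : M := sUnion (sep A fun x => app f x = y)

instance DefF.inv (f g h : (ℕ → M) → M) [DefF f] [DefF g] [DefF h] :
    DefF (fun w => inv (f w) (g w) (h w)) :=
  DefF.comp₃ (F := SetModel.inv) (by unfold SetModel.inv; infer_instance) f g h

theorem inv_app {f A x : M} (h : ∀ x y, x ∈ᴹ A → y ∈ᴹ A → app f x = app f y → x = y)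
    (hx : x ∈ᴹ A) : inv A f (app f x) = x := by
  apply ext
  intro z
  simp only [inv, mem_sUnion, mem_sep]
  constructor
  · rintro ⟨y, ⟨hy, hxy⟩, hz⟩
    rwa [← h y x hy hx hxy]
  · intro hz
    exact ⟨x, ⟨hx, rfl⟩, hz⟩

end SetOperations

/-! ### Natural numbers and finite sets of the model -/

section Naturals

variable {M : Type u} [setLang.Structure M] [hM : ZF M]

instance DefP.isEmptySet (f : (ℕ → M) → M) [DefF f] : DefP (fun w => IsEmptySet (f w)) :=
  DefP.comp₁ (R := IsEmptySet) (by unfold IsEmptySet; infer_instance) f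

instance DefP.isSucc (f g : (ℕ → M) → M) [DefF f] [DefF g] : DefP (fun w => IsSucc (f w) (g w)) :=
  DefP.comp₂ (R := IsSucc) (by unfold IsSucc; infer_instance) f g

instance DefP.isInductive (f : (ℕ → M) → M) [DefF f] : DefP (fun w => IsInductive (f w)) :=
  DefP.comp₁ (R := IsInductive) (by unfold IsInductive; infer_instance) f

instance DefP.isNatural (f : (ℕ → M) → M) [DefF f] : DefP (fun w => IsNatural (f w)) :=
  DefP.comp₁ (R := IsNatural) (by unfold IsNatural; infer_instance) f

instance DefP.maps (f g h : (ℕ → M) → M) [DefF f] [DefF g] [DefF h] :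
    DefP (fun w => Maps (f w) (g w) (h w)) := by
  simp only [maps_iff]
  infer_instance

instance DefP.isFunction (f g h : (ℕ → M) → M) [DefF f] [DefF g] [DefF h] :
    DefP (fun w => IsFunction (f w) (g w) (h w)) :=
  DefP.comp₃ (R := IsFunction)
    (by unfold IsFunction; simp only [isOrderedPair_iff]; infer_instance) f g h

instance DefP.isInjection (f g h : (ℕ → M) → M) [DefF f] [DefF g] [DefF h] :
    DefP (fun w => IsInjection (f w) (g w) (h w)) :=
  DefP.comp₃ (R := IsInjection) (by unfold IsInjection; infer_instance) f g h

instance DefP.isBijection (f g h : (ℕ → M) → M) [DefF f] [DefF g] [DefF h] :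
    DefP (fun w => IsBijection (f w) (g w) (h w)) :=
  DefP.comp₃ (R := IsBijection) (by unfold IsBijection; infer_instance) f g h

instance DefP.isFinite (f : (ℕ → M) → M) [DefF f] : DefP (fun w => IsFinite (f w)) :=
  DefP.comp₁ (R := IsFinite) (by unfold IsFinite; infer_instance) f

/-- The set of natural numbers. -/
noncomputable def omg : M := cls IsNatural

theorem mem_omg_iff {n : M} : n ∈ᴹ omg ↔ IsNatural n := by
  obtain ⟨I, hI⟩ := hM.out.infinity
  obtain ⟨b, hb⟩ := exists_sep I IsNatural
  exact mem_cls ⟨b, fun x => by rw [hb]; exact ⟨fun h => h.2, fun h => ⟨h I hI, h⟩⟩⟩ n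

theorem isOmega_iff {w : M} : IsOmega w ↔ w = omg :=
  ⟨fun h => ext fun n => by rw [h n, mem_omg_iff], fun h n => by rw [h, mem_omg_iff]⟩

theorem isInductive_iff {I : M} :
    IsInductive I ↔ emp ∈ᴹ I ∧ ∀ x, x ∈ᴹ I → ins x x ∈ᴹ I := by
  simp [IsInductive, isEmptySet_iff, isSucc_iff]

@[simp] theorem emp_mem_omg : (emp : M) ∈ᴹ omg :=
  mem_omg_iff.2 fun _ hI => (isInductive_iff.1 hI).1

theorem succ_mem_omg {n : M} (hn : n ∈ᴹ omg) : ins n n ∈ᴹ omg :=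
  mem_omg_iff.2 fun I hI => (isInductive_iff.1 hI).2 n (mem_omg_iff.1 hn I hI)

theorem nat_induction (P : M → Prop) [hP : DefP (fun w => P (w 0))] (h0 : P emp)
    (hs : ∀ n, n ∈ᴹ omg → P n → P (ins n n)) (n : M) (hn : n ∈ᴹ omg) : P n := by
  have : IsInductive (sep omg P) := by
    rw [isInductive_iff]
    refine ⟨mem_sep.2 ⟨emp_mem_omg, h0⟩, fun x hx => ?_⟩
    obtain ⟨h1, h2⟩ := mem_sep.1 hx
    exact mem_sep.2 ⟨succ_mem_omg h1, hs x h1 h2⟩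
  exact (mem_sep.1 (mem_omg_iff.1 hn _ this)).2

theorem mem_irrefl (x : M) : ¬ x ∈ᴹ x := by
  intro h
  obtain ⟨y, hy, hy'⟩ := hM.out.foundation (sing x) (fun h' => h' x (by simp))
  rw [mem_sing] at hy
  subst hy
  exact hy' y ⟨by simp, h⟩

theorem mem_asymm {x y : M} (h : x ∈ᴹ y) : ¬ y ∈ᴹ x := by
  intro h'
  obtain ⟨z, hz, hz'⟩ := hM.out.foundation (upair x y) (fun h' => h' x (by simp))
  rw [mem_upair] at hz
  rcases hz with rfl | rfl
  · exact hz' y ⟨by simp, h'⟩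
  · exact hz' x ⟨by simp, h⟩

theorem mem_omg_of_mem {m n : M} (hn : n ∈ᴹ omg) (hm : m ∈ᴹ n) : m ∈ᴹ omg := by
  refine nat_induction (fun n => ∀ m, m ∈ᴹ n → m ∈ᴹ omg) ?_ ?_ n hn m hm
  · intro m hm
    exact (mem_emp hm).elim
  · intro n hn ih m hm
    rcases mem_ins.1 hm with hm | rfl
    · exact ih m hm
    · exact hn

theorem mem_trans {k m n : M} (hn : n ∈ᴹ omg) (hk : k ∈ᴹ m) (hm : m ∈ᴹ n) : k ∈ᴹ n := by
  refine nat_induction (fun n => ∀ k m, k ∈ᴹ m → m ∈ᴹ n → k ∈ᴹ n) ?_ ?_ n hn k m hk hm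
  · intro k m _ hm
    exact (mem_emp hm).elim
  · intro n hn ih k m hk hm
    rcases mem_ins.1 hm with hm | rfl
    · exact mem_ins.2 (Or.inl (ih k m hk hm))
    · exact mem_ins.2 (Or.inl hk)

theorem succ_mem_or_eq {m n : M} (hn : n ∈ᴹ omg) (hm : m ∈ᴹ n) : ins m m ∈ᴹ n ∨ ins m m = n := by
  refine nat_induction (fun n => ∀ m, m ∈ᴹ n → ins m m ∈ᴹ n ∨ ins m m = n) ?_ ?_ n hn m hm
  · intro m hm
    exact (mem_emp hm).elim
  · intro n hn ih m hm
    rcases mem_ins.1 hm with hm | rfl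
    · rcases ih m hm with h | h
      · exact Or.inl (mem_ins.2 (Or.inl h))
      · exact Or.inl (mem_ins.2 (Or.inr h))
    · exact Or.inr rfl

theorem emp_mem_or_eq {n : M} (hn : n ∈ᴹ omg) : emp ∈ᴹ n ∨ n = emp := by
  refine nat_induction (fun n => emp ∈ᴹ n ∨ n = emp) (Or.inr rfl) ?_ n hn
  rintro n hn (h | rfl)
  · exact Or.inl (mem_ins.2 (Or.inl h))
  · exact Or.inl (mem_ins.2 (Or.inr rfl))

theorem nat_trichotomy {m n : M} (hm : m ∈ᴹ omg) (hn : n ∈ᴹ omg) : n ∈ᴹ m ∨ n = m ∨ m ∈ᴹ n := by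
  refine nat_induction (fun n => ∀ m, m ∈ᴹ omg → n ∈ᴹ m ∨ n = m ∨ m ∈ᴹ n) ?_ ?_ n hn m hm
  · intro m hm
    rcases emp_mem_or_eq hm with h | h
    · exact Or.inl h
    · exact Or.inr (Or.inl h.symm)
  · intro n hn ih m hm
    rcases ih m hm with h | rfl | h
    · rcases succ_mem_or_eq hm h with h | h
      · exact Or.inl h
      · exact Or.inr (Or.inl h)
    · exact Or.inr (Or.inr (mem_ins.2 (Or.inr rfl)))
    · exact Or.inr (Or.inr (mem_ins.2 (Or.inl h)))

/-- Foundation provides an `∈`-minimal member, and trichotomy makes it the least one. -/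
theorem exists_least {s : M} (hs : IsSubset s omg) (hne : ∃ n, n ∈ᴹ s) :
    ∃ n, n ∈ᴹ s ∧ ∀ m, m ∈ᴹ s → n ∈ᴹ m ∨ n = m := by
  obtain ⟨k, hk⟩ := hne
  obtain ⟨n, hn, hn'⟩ := hM.out.foundation s (fun h => h k hk)
  refine ⟨n, hn, fun m hm => ?_⟩
  rcases nat_trichotomy (hs m hm) (hs n hn) with h | h | h
  · exact Or.inl h
  · exact Or.inr h
  · exact (hn' m ⟨hm, h⟩).elim

theorem succ_inj {m n : M} (h : ins m m = ins n n) : m = n := by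
  have h1 : m ∈ᴹ ins n n := by rw [← h]; simp
  have h2 : n ∈ᴹ ins m m := by rw [h]; simp
  rcases mem_ins.1 h1 with h1 | h1
  · rcases mem_ins.1 h2 with h2 | h2
    · exact (mem_asymm h1 h2).elim
    · exact h2.symm
  · exact h1

theorem subset_of_mem_nat {m n : M} (hn : n ∈ᴹ omg) (hm : m ∈ᴹ n) : IsSubset m n :=
  fun _ hk => mem_trans hn hk hm

/-! ### Finite sets -/

theorem finite_of_bijection {X n : M} (hn : n ∈ᴹ omg) {f : M} (hf : IsBijection f X n) :
    IsFinite X := ⟨n, f, mem_omg_iff.1 hn, hf⟩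

theorem finite_nat {n : M} (hn : n ∈ᴹ omg) : IsFinite n :=
  finite_of_bijection hn (isBijection_lam (F := fun x => x) (fun _ h => h) (fun _ _ _ _ h => h)
    (fun y hy => ⟨y, hy, rfl⟩))

theorem finite_emp : IsFinite (emp : M) := finite_nat emp_mem_omg

theorem ins_eq_self {a s : M} (h : a ∈ᴹ s) : ins a s = s :=
  ext fun z => by
    rw [mem_ins]
    constructor
    · rintro (hz | rfl)
      · exact hz
      · exact h
    · exact Or.inl

theorem ins_diff_sing {a s : M} (h : a ∈ᴹ s) : ins a (diff s (sing a)) = s :=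
  ext fun z => by
    by_cases hz : z = a
    · subst hz; simpa using h
    · simp [hz]

open Classical in
theorem finite_ins {s : M} (a : M) (hs : IsFinite s) : IsFinite (ins a s) := by
  by_cases ha : a ∈ᴹ s
  · rwa [ins_eq_self ha]
  obtain ⟨n, f, hn, hf⟩ := hs
  have hn := mem_omg_iff.2 hn
  have hx : ∀ x, x ∈ᴹ s → x ≠ a := by
    rintro x hx rfl
    exact ha hx
  refine finite_of_bijection (succ_mem_omg hn)
    (isBijection_lam (F := fun x => if x = a then n else app f x) ?_ ?_ ?_)
  · intro x hx'
    by_cases h : x = a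
    · simp [h]
    · simp only [h, if_false, mem_ins]
      exact Or.inl (hf.1.1.app_mem ((mem_ins.1 hx').resolve_right h))
  · intro x y hx' hy' h
    by_cases h1 : x = a <;> by_cases h2 : y = a
    · rw [h1, h2]
    · simp only [h1, h2, if_true, if_false] at h
      have := hf.1.1.app_mem ((mem_ins.1 hy').resolve_right h2)
      rw [← h] at this
      exact (mem_irrefl _ this).elim
    · simp only [h1, h2, if_true, if_false] at h
      have := hf.1.1.app_mem ((mem_ins.1 hx').resolve_right h1)
      rw [h] at this
      exact (mem_irrefl _ this).elim
    · simp only [h1, h2, if_false] at h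
      exact hf.1.app_inj ((mem_ins.1 hx').resolve_right h1) ((mem_ins.1 hy').resolve_right h2) h
  · intro y hy
    rcases mem_ins.1 hy with hy | rfl
    · obtain ⟨x, hx', rfl⟩ := hf.exists_app hy
      exact ⟨x, mem_ins.2 (Or.inl hx'), by simp [hx x hx']⟩
    · exact ⟨a, by simp, by simp⟩

/-- Induction on the natural number in bijection with `s`; at a successor, the element removed is
the preimage of the top value. -/
theorem finite_induction (P : M → Prop) [hP : DefP (fun w => P (w 0))] (h0 : P emp)
    (hi : ∀ a s, IsFinite s → ¬ a ∈ᴹ s → P s → P (ins a s)) (s : M) (hs : IsFinite s) : P s := by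
  obtain ⟨n, f, hn, hf⟩ := hs
  have hn := mem_omg_iff.2 hn
  refine nat_induction (fun n => ∀ s, (∃ f, IsBijection f s n) → P s) ?_ ?_ n hn s ⟨f, hf⟩
  · rintro s ⟨f, hf⟩
    have : s = emp := isEmptySet_iff.1 fun z hz => mem_emp (hf.1.1.app_mem hz)
    rwa [this]
  · rintro n hn ih s ⟨f, hf⟩
    obtain ⟨a, ha, rfl⟩ := hf.exists_app (y := n) (by simp)
    have key : ∃ g, IsBijection g (diff s (sing a)) (app f a) := by
      refine ⟨_, isBijection_lam (F := fun x => app f x) ?_ ?_ ?_⟩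
      · intro x hx
        simp only [mem_diff, mem_sing] at hx
        rcases mem_ins.1 (hf.1.1.app_mem hx.1) with h | h
        · exact h
        · exact (hx.2 (hf.1.app_inj hx.1 ha h)).elim
      · intro x y hx hy h
        exact hf.1.app_inj (mem_diff.1 hx).1 (mem_diff.1 hy).1 h
      · intro y hy
        obtain ⟨x, hx, rfl⟩ := hf.exists_app (mem_ins.2 (Or.inl hy))
        refine ⟨x, ?_, rfl⟩
        simp only [mem_diff, mem_sing]
        refine ⟨hx, ?_⟩
        rintro rfl
        exact mem_irrefl _ hy
    rw [← ins_diff_sing ha]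
    exact hi a _ (finite_of_bijection hn key.choose_spec) (by simp) (ih _ key)

theorem finite_subset {s t : M} (hs : IsFinite s) (ht : IsSubset t s) : IsFinite t := by
  refine finite_induction (fun s => ∀ t, IsSubset t s → IsFinite t) ?_ ?_ s hs t ht
  · intro t ht
    have : t = emp := isEmptySet_iff.1 fun z hz => mem_emp (ht z hz)
    rw [this]
    exact finite_emp
  · intro a s _ _ ih t ht
    have h1 : IsFinite (diff t (sing a)) := by
      refine ih _ fun z hz => ?_
      simp only [mem_diff, mem_sing] at hz
      exact (mem_ins.1 (ht z hz.1)).resolve_right hz.2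
    by_cases ha : a ∈ᴹ t
    · rw [← ins_diff_sing ha]
      exact finite_ins a h1
    · have : diff t (sing a) = t := ext fun z => by
        simp only [mem_diff, mem_sing, and_iff_left_iff_imp]
        rintro hz rfl
        exact ha hz
      rwa [← this]

theorem un_emp (s : M) : un s emp = s := ext fun z => by simp

theorem un_ins (s a t : M) : un s (ins a t) = ins a (un s t) := ext fun z => by simp [or_assoc]

theorem finite_un {s t : M} (hs : IsFinite s) (ht : IsFinite t) : IsFinite (un s t) := by
  refine finite_induction (fun t => IsFinite (un s t)) ?_ ?_ t ht
  · rwa [un_emp]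
  · intro a t _ _ ih
    rw [un_ins]
    exact finite_ins a ih

theorem finite_sing (a : M) : IsFinite (sing a) := by
  have : sing a = ins a emp := ext fun z => by simp
  rw [this]
  exact finite_ins a finite_emp

theorem finite_upair (a b : M) : IsFinite (upair a b) := by
  have : upair a b = ins b (sing a) := ext fun z => by simp
  rw [this]
  exact finite_ins b (finite_sing a)

theorem finite_img {s : M} (hs : IsFinite s) (F : M → M) [hF : DefF (fun w => F (w 0))] :
    IsFinite (img s F) := by
  have : DefF (fun w : ℕ → M => F (w 0)) := hF
  refine finite_induction (fun s => IsFinite (img s F)) ?_ ?_ s hs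
  · have : img emp F = emp := isEmptySet_iff.1 fun z hz => by
      obtain ⟨x, hx, -⟩ := mem_img.1 hz
      exact mem_emp hx
    rw [this]
    exact finite_emp
  · intro a s _ _ ih
    have : img (ins a s) F = ins (F a) (img s F) := ext fun z => by
      simp only [mem_img, mem_ins, or_and_right, exists_or, exists_eq_left]
    rw [this]
    exact finite_ins _ ih

theorem sUnion_emp : sUnion (emp : M) = emp := ext fun z => by simp

theorem sUnion_ins (a s : M) : sUnion (ins a s) = un (sUnion s) a := ext fun z => by
  simp [or_and_right, exists_or]

theorem sUnion_sing (a : M) : sUnion (sing a) = a := ext fun z => by simp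

theorem finite_sUnion {s : M} (hs : IsFinite s) (h : ∀ x, x ∈ᴹ s → IsFinite x) :
    IsFinite (sUnion s) := by
  refine finite_induction (fun s => (∀ x, x ∈ᴹ s → IsFinite x) → IsFinite (sUnion s)) ?_ ?_ s hs h
  · intro _
    rw [sUnion_emp]
    exact finite_emp
  · intro a s _ _ ih h
    rw [sUnion_ins]
    exact finite_un (ih fun x hx => h x (mem_ins.2 (Or.inl hx))) (h a (by simp))

theorem finite_prod {s t : M} (hs : IsFinite s) (ht : IsFinite t) : IsFinite (prod s t) := by
  refine finite_sUnion (finite_img hs _) fun x hx => ?_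
  obtain ⟨y, -, rfl⟩ := mem_img.1 hx
  exact finite_img ht _

theorem finite_pow {s : M} (hs : IsFinite s) : IsFinite (pow s) := by
  refine finite_induction (fun s => IsFinite (pow s)) ?_ ?_ s hs
  · refine finite_subset (finite_sing emp) fun z hz => ?_
    rw [mem_sing]
    exact isEmptySet_iff.1 fun t ht => mem_emp (mem_pow.1 hz t ht)
  · intro a s _ _ ih
    refine finite_subset (finite_un ih (finite_img ih fun x => ins a x)) fun z hz => ?_
    rw [mem_un, mem_img]
    rw [mem_pow] at hz
    have hd : IsSubset (diff z (sing a)) s := fun t ht => by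
      simp only [mem_diff, mem_sing] at ht
      exact (mem_ins.1 (hz t ht.1)).resolve_right ht.2
    by_cases ha : a ∈ᴹ z
    · exact Or.inr ⟨_, mem_pow.2 hd, (ins_diff_sing ha).symm⟩
    · refine Or.inl (mem_pow.2 fun t ht => ?_)
      refine (mem_ins.1 (hz t ht)).resolve_right ?_
      rintro rfl
      exact ha ht

theorem finite_of_injection {s t f : M} (ht : IsFinite t) (hf : IsInjection f s t) :
    IsFinite s := by
  have h1 : IsFinite (img t fun y => inv s f y) := finite_img ht _
  refine finite_subset h1 fun x hx => ?_
  exact mem_img.2 ⟨app f x, hf.1.app_mem hx, (inv_app (fun x y hx hy => hf.app_inj hx hy) hx).symm⟩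

theorem exists_bound {s : M} (hs : IsFinite s) (h : IsSubset s omg) :
    ∃ n, n ∈ᴹ omg ∧ IsSubset s n := by
  refine finite_induction (fun s => IsSubset s omg → ∃ n, n ∈ᴹ omg ∧ IsSubset s n) ?_ ?_ s hs h
  · intro _
    exact ⟨emp, by simp, fun _ h => h⟩
  · intro a s _ _ ih h
    obtain ⟨n, hn, hsn⟩ := ih fun x hx => h x (mem_ins.2 (Or.inl hx))
    have ha := h a (by simp)
    rcases nat_trichotomy ha hn with h | rfl | h
    · refine ⟨ins a a, succ_mem_omg ha, fun x hx => mem_ins.2 ?_⟩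
      rcases mem_ins.1 hx with hx | hx
      · exact Or.inl (mem_trans ha (hsn x hx) h)
      · exact Or.inr hx
    · refine ⟨ins n n, succ_mem_omg ha, fun x hx => mem_ins.2 ?_⟩
      rcases mem_ins.1 hx with hx | hx
      · exact Or.inl (hsn x hx)
      · exact Or.inr hx
    · refine ⟨n, hn, fun x hx => ?_⟩
      rcases mem_ins.1 hx with hx | rfl
      · exact hsn x hx
      · exact h

theorem infinite_omg : IsInfinite (omg : M) := by
  intro h
  obtain ⟨n, hn, h'⟩ := exists_bound h (subset_refl _)
  exact mem_irrefl n (h' n hn)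

theorem isDedekindInfinite_iff {X : M} : IsDedekindInfinite X ↔ ∃ f, IsInjection f omg X := by
  simp [IsDedekindInfinite, isOmega_iff]

theorem IsDedekindInfinite.isInfinite {X : M} (h : IsDedekindInfinite X) : IsInfinite X := by
  obtain ⟨f, hf⟩ := isDedekindInfinite_iff.1 h
  exact fun hX => infinite_omg (finite_of_injection hX hf)

instance DefP.isInfinite (f : (ℕ → M) → M) [DefF f] : DefP (fun w => IsInfinite (f w)) :=
  inferInstanceAs (DefP (fun w => ¬ IsFinite (f w)))

theorem IsInfinite.diff {s t : M} (hs : IsInfinite s) (ht : IsFinite t) :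
    IsInfinite (diff s t) := fun h =>
  hs (finite_subset (finite_un h ht) fun z hz => by
    rw [mem_un, mem_diff]
    by_cases hzt : z ∈ᴹ t
    · exact Or.inr hzt
    · exact Or.inl ⟨hz, hzt⟩)

theorem IsInfinite.exists_mem {s : M} (hs : IsInfinite s) : ∃ x, x ∈ᴹ s := by
  by_contra h
  push Not at h
  refine hs ?_
  rw [isEmptySet_iff.1 h]
  exact finite_emp

end Naturals

/-! ### Recursion, choice functions available in ZF, greedy constructions, cardinality -/

section Recursion

variable {M : Type u} [setLang.Structure M] [hM : ZF M]

/-- Recursion on the natural numbers. -/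
theorem exists_recursion {S a g : M} (ha : a ∈ᴹ S) (hg : ∀ x, x ∈ᴹ S → app g x ∈ᴹ S) :
    ∃ h, IsFunction h omg S ∧ app h emp = a ∧
      ∀ n, n ∈ᴹ omg → app h (ins n n) = app g (app h n) := by
  -- The function is the intersection of all relations closed under the two recursion clauses.
  -- Minimality gives inversion (`hinv`): a pair produced by neither clause could be deleted.
  let Closed : M → Prop := fun R => opair emp a ∈ᴹ R ∧
    ∀ n x, n ∈ᴹ omg → x ∈ᴹ S → opair n x ∈ᴹ R → opair (ins n n) (app g x) ∈ᴹ R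
  let h := sep (prod omg S) fun p => ∀ R, Closed R → p ∈ᴹ R
  have mem_h : ∀ {n x}, opair n x ∈ᴹ h ↔ (n ∈ᴹ omg ∧ x ∈ᴹ S) ∧ ∀ R, Closed R → opair n x ∈ᴹ R := by
    intro n x
    rw [← opair_mem_prod]
    exact mem_sep
  have h0 : opair emp a ∈ᴹ h := mem_h.2 ⟨⟨emp_mem_omg, ha⟩, fun R hR => hR.1⟩
  have hs : ∀ n x, opair n x ∈ᴹ h → opair (ins n n) (app g x) ∈ᴹ h := by
    intro n x hx
    obtain ⟨⟨hn, hx⟩, h'⟩ := mem_h.1 hx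
    exact mem_h.2 ⟨⟨succ_mem_omg hn, hg x hx⟩, fun R hR => hR.2 n x hn hx (h' R hR)⟩
  have hinv : ∀ n x, opair n x ∈ᴹ h → (n = emp ∧ x = a) ∨
      ∃ m y, opair m y ∈ᴹ h ∧ n = ins m m ∧ x = app g y := by
    intro n x hx
    by_contra hc
    push Not at hc
    have : Closed (diff h (sing (opair n x))) := by
      refine ⟨?_, fun m y hm hy hmy => ?_⟩
      · simp only [mem_diff, mem_sing, opair_inj]
        exact ⟨h0, fun h' => hc.1 h'.1.symm h'.2.symm⟩
      · simp only [mem_diff, mem_sing, opair_inj] at hmy ⊢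
        exact ⟨hs m y hmy.1, fun h' => hc.2 m y hmy.1 h'.1.symm h'.2.symm⟩
    have := (mem_h.1 hx).2 _ this
    simp at this
  have hu : ∀ n, n ∈ᴹ omg → ∃! x, opair n x ∈ᴹ h := by
    refine nat_induction _ ?_ ?_
    · refine ⟨a, h0, fun y hy => ?_⟩
      rcases hinv _ _ hy with ⟨-, h'⟩ | ⟨m, z, -, h', -⟩
      · exact h'
      · exact (mem_emp (x := m) (by rw [h']; simp)).elim
    · rintro n hn ⟨x, hx, hx'⟩
      refine ⟨app g x, hs n x hx, fun y hy => ?_⟩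
      rcases hinv _ _ hy with ⟨h', -⟩ | ⟨m, z, hz, h', rfl⟩
      · exact (mem_emp (x := n) (by rw [← h']; simp)).elim
      · obtain rfl := succ_inj h'
        rw [hx' z hz]
  have hf : IsFunction h omg S := by
    refine ⟨fun p hp => ?_, fun n hn => by simpa only [maps_iff] using hu n hn⟩
    obtain ⟨x, y, hx, hy, rfl⟩ := mem_prod.1 (mem_sep.1 hp).1
    exact ⟨x, y, hx, hy, isOrderedPair_iff.2 rfl⟩
  refine ⟨h, hf, (hf.mem_iff.1 h0).2.symm, fun n hn => ?_⟩
  exact (hf.mem_iff.1 (hs n _ (hf.maps_app hn))).2.symm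

/-- The nonempty subsets of `S` have a choice function. -/
def Choosable (S : M) : Prop :=
  ∃ g, ∀ A, IsSubset A S → (∃ x, x ∈ᴹ A) → app g A ∈ᴹ A

/-- Definite description: the union of a singleton is its element, so uniqueness alone yields a
definable term. -/
theorem sUnion_sep_eq {A x : M} {P : M → Prop} [DefP (fun w => P (w 0))] (hx : x ∈ᴹ A) (hP : P x)
    (hu : ∀ y, y ∈ᴹ A → P y → y = x) : sUnion (sep A P) = x := by
  have : sep A P = sing x := ext fun y => by
    rw [mem_sep, mem_sing]
    constructor
    · rintro ⟨h1, h2⟩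
      exact hu y h1 h2
    · rintro rfl
      exact ⟨hx, hP⟩
  rw [this, sUnion_sing]

theorem choosable_of_injection {S T f : M} (hf : IsInjection f S T) (hT : Choosable T) :
    Choosable S := by
  obtain ⟨g, hg⟩ := hT
  refine ⟨lam (pow S) fun A => inv S f (app g (img A fun x => app f x)), fun A hA hne => ?_⟩
  rw [app_lam (mem_pow.2 hA)]
  have h1 : app g (img A fun x => app f x) ∈ᴹ img A fun x => app f x := by
    refine hg _ (fun y hy => ?_) ?_
    · obtain ⟨x, hx, rfl⟩ := mem_img.1 hy
      exact hf.1.app_mem (hA x hx)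
    · obtain ⟨x, hx⟩ := hne
      exact ⟨_, mem_img.2 ⟨x, hx, rfl⟩⟩
  obtain ⟨x, hx, h2⟩ := mem_img.1 h1
  rw [h2, inv_app (fun x y hx hy => hf.app_inj hx hy) (hA x hx)]
  exact hx

theorem choosable_omg : Choosable (omg : M) := by
  refine ⟨lam (pow omg) fun A => sUnion (sep A fun n => ∀ m, m ∈ᴹ A → n ∈ᴹ m ∨ n = m),
    fun A hA hne => ?_⟩
  rw [app_lam (mem_pow.2 hA)]
  obtain ⟨n, hn, hn'⟩ := exists_least hA hne
  rw [sUnion_sep_eq hn hn']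
  · exact hn
  · intro m hm hm'
    rcases hn' m hm with h | h
    · rcases hm' n hn with h' | h'
      · exact (mem_asymm h h').elim
      · exact h'
    · exact h.symm

/-- `[X]^{<ω}` -/
noncomputable def finpow (X : M) : M := sep (pow X) IsFinite

theorem mem_finpow {X s : M} : s ∈ᴹ finpow X ↔ IsSubset s X ∧ IsFinite s := by
  rw [finpow, mem_sep, mem_pow]

instance DefF.finpow (f : (ℕ → M) → M) [DefF f] : DefF (fun w => finpow (f w)) :=
  DefF.comp₁ (F := SetModel.finpow) (by unfold SetModel.finpow; infer_instance) f

/-- Comparison of sets of natural numbers by the largest element of their symmetric difference. -/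
def LexLt (s t : M) : Prop :=
  ∃ m, m ∈ᴹ t ∧ ¬ m ∈ᴹ s ∧ ∀ k, k ∈ᴹ omg → m ∈ᴹ k → (k ∈ᴹ s ↔ k ∈ᴹ t)

instance DefP.lexLt (f g : (ℕ → M) → M) [DefF f] [DefF g] : DefP (fun w => LexLt (f w) (g w)) :=
  DefP.comp₂ (R := LexLt) (by unfold LexLt; infer_instance) f g

theorem lexLt_asymm {s t : M} (hs : IsSubset s omg) (ht : IsSubset t omg) (h : LexLt s t) :
    ¬ LexLt t s := by
  rintro ⟨m, hm, hm', hm''⟩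
  obtain ⟨n, hn, hn', hn''⟩ := h
  rcases nat_trichotomy (hs m hm) (ht n hn) with h | h | h
  · exact hm' ((hn'' m (hs m hm) h).1 hm)
  · exact hn' (h ▸ hm)
  · exact hn' ((hm'' n (ht n hn) h).1 hn)

/-- In the induction the top element `n` is decisive. If some member of `A` omits it, only such
members compete; otherwise it is removed from all members, and restored after the induction
hypothesis has been used. -/
theorem exists_lexLeast {n : M} (hn : n ∈ᴹ omg) {A : M} (hA : ∀ t, t ∈ᴹ A → IsSubset t n)
    (hne : ∃ t, t ∈ᴹ A) : ∃ u, u ∈ᴹ A ∧ ∀ t, t ∈ᴹ A → t = u ∨ LexLt u t := by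
  refine nat_induction (fun n => ∀ A, (∀ t, t ∈ᴹ A → IsSubset t n) → (∃ t, t ∈ᴹ A) →
    ∃ u, u ∈ᴹ A ∧ ∀ t, t ∈ᴹ A → t = u ∨ LexLt u t) ?_ ?_ n hn A hA hne
  · rintro A hA ⟨t, ht⟩
    have : ∀ s, s ∈ᴹ A → s = emp := fun s hs => isEmptySet_iff.1 fun z hz => mem_emp (hA s hs z hz)
    exact ⟨t, ht, fun s hs => Or.inl ((this s hs).trans (this t ht).symm)⟩
  · rintro n hn ih A hA ⟨t₀, ht₀⟩
    have above : ∀ t k, t ∈ᴹ A → n ∈ᴹ k → ¬ k ∈ᴹ t := by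
      intro t k ht hnk hk
      rcases mem_ins.1 (hA t ht k hk) with h | rfl
      · exact mem_asymm h hnk
      · exact mem_irrefl _ hnk
    by_cases h : ∃ t, t ∈ᴹ A ∧ ¬ n ∈ᴹ t
    · obtain ⟨t, ht, hnt⟩ := h
      obtain ⟨u, hu, hu'⟩ := ih (sep A fun t => ¬ n ∈ᴹ t) (fun t ht k hk => by
        obtain ⟨h1, h2⟩ := mem_sep.1 ht
        refine (mem_ins.1 (hA t h1 k hk)).resolve_right ?_
        rintro rfl
        exact h2 hk) ⟨t, mem_sep.2 ⟨ht, hnt⟩⟩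
      obtain ⟨huA, hun⟩ := mem_sep.1 hu
      refine ⟨u, huA, fun s hs => ?_⟩
      by_cases hns : n ∈ᴹ s
      · exact Or.inr ⟨n, hns, hun, fun k _ hk => iff_of_false (above u k huA hk) (above s k hs hk)⟩
      · exact hu' s (mem_sep.2 ⟨hs, hns⟩)
    · push Not at h
      obtain ⟨u, hu, hu'⟩ := ih (img A fun t => diff t (sing n)) (fun t ht k hk => by
        obtain ⟨s, hs, rfl⟩ := mem_img.1 ht
        simp only [mem_diff, mem_sing] at hk
        exact (mem_ins.1 (hA s hs k hk.1)).resolve_right hk.2) ⟨_, mem_img.2 ⟨t₀, ht₀, rfl⟩⟩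
      obtain ⟨v, hv, rfl⟩ := mem_img.1 hu
      refine ⟨v, hv, fun s hs => ?_⟩
      rcases hu' _ (mem_img.2 ⟨s, hs, rfl⟩) with h1 | ⟨m, hm, hm', hm''⟩
      · left
        rw [← ins_diff_sing (h s hs), h1, ins_diff_sing (h v hv)]
      · right
        simp only [mem_diff, mem_sing] at hm hm' hm''
        refine ⟨m, hm.1, fun h' => hm' ⟨h', hm.2⟩, fun k hk hmk => ?_⟩
        by_cases hkn : k = n
        · subst hkn
          exact iff_of_true (h v hv) (h s hs)
        · simpa [hkn] using hm'' k hk hmk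

/-- The choice is made in two stages: minimise the bound `n` below which some member of `A` lies,
then take the `LexLt`-least member below that bound. `R A u` expresses that `u` is the result. -/
theorem choosable_finpow_omg : Choosable (finpow (omg : M)) := by
  let R : M → M → Prop := fun A u => ∃ n, n ∈ᴹ omg ∧ IsSubset u n ∧
    (∀ t, t ∈ᴹ A → IsSubset t n → t = u ∨ LexLt u t) ∧
    ∀ m, m ∈ᴹ n → ∀ t, t ∈ᴹ A → ¬ IsSubset t m
  refine ⟨lam (pow (finpow omg)) fun A => sUnion (sep A fun u => R A u), fun A hA hne => ?_⟩
  rw [app_lam (mem_pow.2 hA)]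
  have hex : ∃ u, u ∈ᴹ A ∧ R A u := by
    obtain ⟨t, ht⟩ := hne
    obtain ⟨k, hk, htk⟩ := exists_bound (mem_finpow.1 (hA t ht)).2 (mem_finpow.1 (hA t ht)).1
    obtain ⟨n, hn, hn'⟩ := exists_least (s := sep omg fun n => ∃ t, t ∈ᴹ A ∧ IsSubset t n)
      (fun x hx => (mem_sep.1 hx).1) ⟨k, mem_sep.2 ⟨hk, t, ht, htk⟩⟩
    obtain ⟨hn1, s, hs, hsn⟩ := mem_sep.1 hn
    obtain ⟨u, hu, hu'⟩ := exists_lexLeast hn1 (A := sep A fun t => IsSubset t n)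
      (fun t ht => (mem_sep.1 ht).2) ⟨s, mem_sep.2 ⟨hs, hsn⟩⟩
    obtain ⟨huA, hun⟩ := mem_sep.1 hu
    refine ⟨u, huA, n, hn1, hun, fun t ht htn => hu' t (mem_sep.2 ⟨ht, htn⟩),
      fun m hm t ht htm => ?_⟩
    rcases hn' m (mem_sep.2 ⟨mem_omg_of_mem hn1 hm, t, ht, htm⟩) with h | rfl
    · exact mem_asymm h hm
    · exact mem_irrefl _ hm
  obtain ⟨u, hu, huR⟩ := hex
  rw [sUnion_sep_eq (P := fun u => R A u) hu huR]
  · exact hu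
  · rintro v hv ⟨m, hm, hvm, hv1, hv2⟩
    obtain ⟨n, hn, hun, hu1, hu2⟩ := huR
    rcases nat_trichotomy hm hn with h | rfl | h
    · exact (hv2 n h u hu hun).elim
    · rcases hu1 v hv hvm with h | h
      · exact h
      · rcases hv1 u hu hun with h' | h'
        · exact h'.symm
        · exact (lexLt_asymm (mem_finpow.1 (hA u hu)).1 (mem_finpow.1 (hA v hv)).1 h h').elim
    · exact (hu2 m h v hv hvm).elim

theorem choosable_finpow_of_injection {W f : M} (hf : IsInjection f W omg) :
    Choosable (finpow W) := by
  refine choosable_of_injection (f := lam (finpow W) fun s => img s fun x => app f x)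
    (isInjection_lam ?_ ?_) choosable_finpow_omg
  · intro s hs
    obtain ⟨h1, h2⟩ := mem_finpow.1 hs
    refine mem_finpow.2 ⟨fun y hy => ?_, finite_img h2 _⟩
    obtain ⟨x, hx, rfl⟩ := mem_img.1 hy
    exact hf.1.app_mem (h1 x hx)
  · have key : ∀ s t, IsSubset s W → IsSubset t W →
        (img s fun x => app f x) = (img t fun x => app f x) → IsSubset s t := by
      intro s t hs ht h x hx
      have h1 : app f x ∈ᴹ img s fun x => app f x := mem_img.2 ⟨x, hx, rfl⟩
      rw [h] at h1
      obtain ⟨y, hy, hxy⟩ := mem_img.1 h1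
      rwa [hf.app_inj (hs x hx) (ht y hy) hxy]
    intro s t hs ht h
    have h1 := (mem_finpow.1 hs).1
    have h2 := (mem_finpow.1 ht).1
    exact subset_antisymm (key s t h1 h2 h) (key t s h2 h1 h.symm)

/-- A Dedekind-infinite set has an infinite subset that injects into `ω`. -/
theorem IsDedekindInfinite.exists_countable {X : M} (hX : IsDedekindInfinite X) :
    ∃ W f, IsSubset W X ∧ IsInfinite W ∧ IsInjection f W omg := by
  obtain ⟨f, hf⟩ := isDedekindInfinite_iff.1 hX
  have hinj : ∀ x y, x ∈ᴹ omg → y ∈ᴹ omg → app f x = app f y → x = y :=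
    fun x y hx hy => hf.app_inj hx hy
  refine ⟨img omg fun n => app f n, lam (img omg fun n => app f n) fun x => inv omg f x,
    ?_, ?_, isInjection_lam ?_ ?_⟩
  · intro y hy
    obtain ⟨n, hn, rfl⟩ := mem_img.1 hy
    exact hf.1.app_mem hn
  · refine IsDedekindInfinite.isInfinite (isDedekindInfinite_iff.2
      ⟨lam omg fun n => app f n, isInjection_lam ?_ hinj⟩)
    exact fun n hn => mem_img.2 ⟨n, hn, rfl⟩
  · intro y hy
    obtain ⟨n, hn, rfl⟩ := mem_img.1 hy
    rwa [inv_app hinj hn]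
  · intro x y hx hy h
    obtain ⟨n, hn, rfl⟩ := mem_img.1 hx
    obtain ⟨m, hm, rfl⟩ := mem_img.1 hy
    rw [inv_app hinj hn, inv_app hinj hm] at h
    rw [h]

/-- If every member of a family of finite sets, closed under subsets, can be properly extended
within the family, then there is an infinite set all of whose finite subsets are in the family. -/
theorem exists_infinite_of_extension {S G : M} (hS : Choosable S) (h0 : emp ∈ᴹ G)
    (hGS : ∀ E, E ∈ᴹ G → IsSubset E S) (hsub : ∀ E F, E ∈ᴹ G → IsSubset F E → F ∈ᴹ G)
    (hext : ∀ E, E ∈ᴹ G → ∃ d, d ∈ᴹ S ∧ ¬ d ∈ᴹ E ∧ ins d E ∈ᴹ G) :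
    ∃ D, IsSubset D S ∧ IsDedekindInfinite D ∧ ∀ F, IsSubset F D → IsFinite F → F ∈ᴹ G := by
  obtain ⟨g, hg⟩ := hS
  -- The recursion runs on `G` itself, and the one function `g` picks the new element from a
  -- definable set of admissible extensions, so dependent choice is not needed.
  let nxt : M → M := fun E => app g (sep S fun d => ¬ d ∈ᴹ E ∧ ins d E ∈ᴹ G)
  have hnxt : ∀ E, E ∈ᴹ G → nxt E ∈ᴹ S ∧ ¬ nxt E ∈ᴹ E ∧ ins (nxt E) E ∈ᴹ G := by
    intro E hE
    obtain ⟨d, hd, hd'⟩ := hext E hE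
    exact mem_sep.1 (hg (sep S fun d => ¬ d ∈ᴹ E ∧ ins d E ∈ᴹ G)
      (fun x hx => (mem_sep.1 hx).1) ⟨d, mem_sep.2 ⟨hd, hd'⟩⟩)
  have happ : ∀ E, E ∈ᴹ G → app (lam G fun E => ins (nxt E) E) E = ins (nxt E) E :=
    fun E hE => app_lam (F := fun E => ins (nxt E) E) hE
  obtain ⟨h, hh, hh0, hhs⟩ := exists_recursion (S := G) (a := emp)
    (g := lam G fun E => ins (nxt E) E) h0 fun E hE => by
      rw [happ E hE]
      exact (hnxt E hE).2.2
  have hhs' : ∀ n, n ∈ᴹ omg → app h (ins n n) = ins (nxt (app h n)) (app h n) := fun n hn => by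
    rw [hhs n hn, happ _ (hh.app_mem hn)]
  have mono : ∀ m, m ∈ᴹ omg → ∀ n, n ∈ᴹ m → IsSubset (ins (nxt (app h n)) (app h n)) (app h m) := by
    refine nat_induction _ ?_ ?_
    · intro n hn
      exact (mem_emp hn).elim
    · intro m hm ih n hn
      rw [hhs' m hm]
      rcases mem_ins.1 hn with hn | rfl
      · exact fun x hx => mem_ins.2 (Or.inl (ih n hn x hx))
      · exact subset_refl _
  have mono' : ∀ m n, m ∈ᴹ omg → n ∈ᴹ m → IsSubset (app h n) (app h m) :=
    fun m n hm hn x hx => mono m hm n hn x (mem_ins.2 (Or.inl hx))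
  let D := sUnion (img omg fun n => app h n)
  have mem_D : ∀ {x}, x ∈ᴹ D ↔ ∃ n, n ∈ᴹ omg ∧ x ∈ᴹ app h n := by
    intro x
    simp only [D, mem_sUnion, mem_img]
    constructor
    · rintro ⟨_, ⟨n, hn, rfl⟩, hx⟩
      exact ⟨n, hn, hx⟩
    · rintro ⟨n, hn, hx⟩
      exact ⟨_, ⟨n, hn, rfl⟩, hx⟩
  refine ⟨D, ?_, ?_, ?_⟩
  · intro x hx
    obtain ⟨n, hn, hx⟩ := mem_D.1 hx
    exact hGS _ (hh.app_mem hn) x hx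
  · refine isDedekindInfinite_iff.2 ⟨lam omg fun n => nxt (app h n), isInjection_lam ?_ ?_⟩
    · intro n hn
      refine mem_D.2 ⟨ins n n, succ_mem_omg hn, ?_⟩
      rw [hhs' n hn]
      simp
    · have key : ∀ n m, m ∈ᴹ omg → n ∈ᴹ m → nxt (app h n) ≠ nxt (app h m) := by
        intro n m hm hn he
        refine (hnxt _ (hh.app_mem hm)).2.1 ?_
        rw [← he]
        exact mono m hm n hn _ (by simp)
      intro n m hn hm he
      rcases nat_trichotomy hm hn with h | h | h
      · exact (key n m hm h he).elim
      · exact h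
      · exact (key m n hn h he.symm).elim
  · intro F hF hfin
    have : ∃ n, n ∈ᴹ omg ∧ IsSubset F (app h n) := by
      refine finite_induction
        (fun F => IsSubset F D → ∃ n, n ∈ᴹ omg ∧ IsSubset F (app h n)) ?_ ?_ F hfin hF
      · intro _
        exact ⟨emp, emp_mem_omg, fun x hx => (mem_emp hx).elim⟩
      · intro a s _ _ ih hs
        obtain ⟨n, hn, hsn⟩ := ih fun x hx => hs x (mem_ins.2 (Or.inl hx))
        obtain ⟨m, hm, ham⟩ := mem_D.1 (hs a (by simp))
        rcases nat_trichotomy hm hn with h' | rfl | h'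
        · refine ⟨m, hm, fun x hx => ?_⟩
          rcases mem_ins.1 hx with hx | rfl
          · exact mono' m n hm h' x (hsn x hx)
          · exact ham
        · refine ⟨n, hn, fun x hx => ?_⟩
          rcases mem_ins.1 hx with hx | rfl
          · exact hsn x hx
          · exact ham
        · refine ⟨n, hn, fun x hx => ?_⟩
          rcases mem_ins.1 hx with hx | rfl
          · exact hsn x hx
          · exact mono' n m hn h' x ham
    obtain ⟨n, hn, hFn⟩ := this
    exact hsub _ F (hh.app_mem hn) hFn

/-! ### Cardinality of finite sets -/

open Classical in
/-- A finite set does not inject into a proper subset. -/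
theorem eq_of_injection_subset {s t f : M} (hs : IsFinite s) (hf : IsInjection f s t)
    (hts : IsSubset t s) : t = s := by
  refine finite_induction (fun s => ∀ t f, IsInjection f s t → IsSubset t s → t = s) ?_ ?_
    s hs t f hf hts
  · intro t f _ hts
    exact isEmptySet_iff.1 fun z hz => mem_emp (hts z hz)
  · intro a s _ ha ih t f hf hts
    have hmem : ∀ x, x ∈ᴹ s → x ∈ᴹ ins a s := fun x hx => mem_ins.2 (Or.inl hx)
    have hne : ∀ x, x ∈ᴹ s → app f x ≠ app f a := fun x hx h => by
      rw [hf.app_inj (hmem x hx) (by simp) h] at hx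
      exact ha hx
    -- If `a ∈ t`, the point of `s` sent to `a`, if any, is rerouted to `f a`, so `s` injects into
    -- `t \ {a}`. If `a ∉ t`, then `t ⊆ s` and `f` on `s` misses `f a`, so the induction hypothesis
    -- gives `t \ {f a} = s`, although `f a ∈ s`.
    by_cases hat : a ∈ᴹ t
    · have hd : IsSubset (diff t (sing a)) s := fun x hx => by
        simp only [mem_diff, mem_sing] at hx
        exact (mem_ins.1 (hts x hx.1)).resolve_right hx.2
      have := ih _ _ (isInjection_lam (A := s) (B := diff t (sing a))
        (F := fun x => if app f x = a then app f a else app f x) (fun x hx => by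
          by_cases h : app f x = a
          · simp only [h, if_true, mem_diff, mem_sing]
            exact ⟨hf.1.app_mem (by simp), fun h' => hne x hx (h.trans h'.symm)⟩
          · simp only [h, if_false, mem_diff, mem_sing]
            exact ⟨hf.1.app_mem (hmem x hx), not_false⟩)
        (fun x y hx hy h => by
          by_cases h1 : app f x = a <;> by_cases h2 : app f y = a
          · exact hf.app_inj (hmem x hx) (hmem y hy) (h1.trans h2.symm)
          · simp only [h1, h2, if_true, if_false] at h
            exact (hne y hy h.symm).elim
          · simp only [h1, h2, if_true, if_false] at h
            exact (hne x hx h).elim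
          · simp only [h1, h2, if_false] at h
            exact hf.app_inj (hmem x hx) (hmem y hy) h)) hd
      rw [← this, ins_diff_sing hat]
    · have hts' : IsSubset t s := fun x hx => by
        refine (mem_ins.1 (hts x hx)).resolve_right ?_
        rintro rfl
        exact hat hx
      have := ih _ _ (isInjection_lam (A := s) (B := diff t (sing (app f a)))
        (F := fun x => app f x) (fun x hx => by
          simp only [mem_diff, mem_sing]
          exact ⟨hf.1.app_mem (hmem x hx), hne x hx⟩)
        (fun x y hx hy h => hf.app_inj (hmem x hx) (hmem y hy) h))
        (fun x hx => hts' x (mem_diff.1 hx).1)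
      have h1 : app f a ∈ᴹ s := hts' _ (hf.1.app_mem (by simp))
      rw [← this] at h1
      simp at h1

/-- `X` injects into `Y`. -/
def Inj (X Y : M) : Prop := ∃ f, IsInjection f X Y

instance DefP.inj (f g : (ℕ → M) → M) [DefF f] [DefF g] : DefP (fun w => Inj (f w) (g w)) :=
  DefP.comp₂ (R := Inj) (by unfold Inj; infer_instance) f g

theorem Inj.trans {X Y Z : M} (h : Inj X Y) (h' : Inj Y Z) : Inj X Z := by
  obtain ⟨f, hf⟩ := h
  obtain ⟨g, hg⟩ := h'
  exact ⟨lam X fun x => app g (app f x), isInjection_lam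
    (fun x hx => hg.1.app_mem (hf.1.app_mem hx))
    fun x y hx hy h => hf.app_inj hx hy (hg.app_inj (hf.1.app_mem hx) (hf.1.app_mem hy) h)⟩

theorem Inj.of_subset {X Y : M} (h : IsSubset X Y) : Inj X Y :=
  ⟨lam X fun x => x, isInjection_lam (F := fun x => x) h fun _ _ _ _ h => h⟩

theorem inj_of_bijection {f X Y : M} (hf : IsBijection f X Y) : Inj Y X := by
  have hinj : ∀ x y, x ∈ᴹ X → y ∈ᴹ X → app f x = app f y → x = y :=
    fun x y hx hy => hf.1.app_inj hx hy
  refine ⟨lam Y fun y => inv X f y, isInjection_lam ?_ ?_⟩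
  · intro y hy
    obtain ⟨x, hx, rfl⟩ := hf.exists_app hy
    rwa [inv_app hinj hx]
  · intro y z hy hz h
    obtain ⟨x, hx, rfl⟩ := hf.exists_app hy
    obtain ⟨x', hx', rfl⟩ := hf.exists_app hz
    rw [inv_app hinj hx, inv_app hinj hx'] at h
    rw [h]

theorem nat_eq_of_inj {m n : M} (hm : m ∈ᴹ omg) (hn : n ∈ᴹ omg) (h : Inj m n) (h' : Inj n m) :
    m = n := by
  rcases nat_trichotomy hm hn with h1 | h1 | h1
  · obtain ⟨f, hf⟩ := h
    exact (eq_of_injection_subset (finite_nat hm) hf (subset_of_mem_nat hm h1)).symm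
  · exact h1.symm
  · obtain ⟨f, hf⟩ := h'
    exact eq_of_injection_subset (finite_nat hn) hf (subset_of_mem_nat hn h1)

/-- The cardinality of a finite set. -/
noncomputable def card (s : M) : M := sUnion (sep omg fun n => Inj s n ∧ Inj n s)

instance DefF.card (f : (ℕ → M) → M) [DefF f] : DefF (fun w => card (f w)) :=
  DefF.comp₁ (F := SetModel.card) (by unfold SetModel.card; infer_instance) f

/-- Cardinality is tested by injections both ways, which spares later counts the construction of
bijections; `nat_eq_of_inj` provides uniqueness. -/
theorem card_eq {s n : M} (hn : n ∈ᴹ omg) (h : Inj s n) (h' : Inj n s) : card s = n :=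
  sUnion_sep_eq (P := fun n => Inj s n ∧ Inj n s) hn ⟨h, h'⟩ fun _ hm hm' =>
    nat_eq_of_inj hm hn (hm'.2.trans h) (h'.trans hm'.1)

theorem card_spec {s : M} (hs : IsFinite s) :
    card s ∈ᴹ omg ∧ Inj s (card s) ∧ Inj (card s) s := by
  obtain ⟨n, f, hn, hf⟩ := hs
  have hn := mem_omg_iff.2 hn
  have h1 : Inj s n := ⟨f, hf.1⟩
  have h2 : Inj n s := inj_of_bijection hf
  rw [card_eq hn h1 h2]
  exact ⟨hn, h1, h2⟩

end Recursion

/-! ### Ramsey's theorem for pairs -/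

section Ramsey

variable {M : Type u} [setLang.Structure M] [hM : ZF M]

theorem isTwo_mem {t z : M} (ht : IsTwo t) : z ∈ᴹ t ↔ z = emp ∨ z = ins emp emp := by
  obtain ⟨e, o, he, ho, ht⟩ := ht
  rw [isEmptySet_iff] at he
  rw [isSucc_iff] at ho ht
  subst he ho ht
  simp

theorem emp_ne_one : (emp : M) ≠ ins emp emp := fun h =>
  mem_emp (x := (emp : M)) (by nth_rw 2 [h]; simp)

theorem exists_isTwo : ∃ t : M, IsTwo t :=
  ⟨_, emp, ins emp emp, isEmptySet_iff.2 rfl, isSucc_iff.2 rfl, isSucc_iff.2 rfl⟩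

theorem upair_comm (x y : M) : upair x y = upair y x := ext fun z => by simp [or_comm]

/-- Ramsey's theorem for pairs from a choosable infinite set, as a dichotomy. -/
theorem exists_homogeneous {W c : M} (hW : Choosable W) (hinf : IsInfinite W) :
    ∃ D, IsSubset D W ∧ IsInfinite D ∧
      ((∀ x y, x ∈ᴹ D → y ∈ᴹ D → x ≠ y → app c (upair x y) = emp) ∨
        ∀ x y, x ∈ᴹ D → y ∈ᴹ D → x ≠ y → app c (upair x y) ≠ emp) := by
  have mem_l : ∀ x y : M, x ∈ᴹ upair x y := by simp
  have mem_r : ∀ x y : M, y ∈ᴹ upair x y := by simp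
  have sub : ∀ x y D : M, x ∈ᴹ D → y ∈ᴹ D → IsSubset (upair x y) D := by
    intro x y D hx hy z hz
    rcases mem_upair.1 hz with rfl | rfl <;> assumption
  -- Either inside some infinite `A` every infinite `B` has a point joined in colour `emp` to
  -- infinitely many points of `B`, and a set of that colour grows inside shrinking reservoirs; or
  -- some infinite `B` has only finitely many such neighbours at each of its points, and these can
  -- be avoided.
  by_cases h : ∃ A, IsSubset A W ∧ IsInfinite A ∧ ∀ B, IsSubset B A → IsInfinite B →
      ∃ x, x ∈ᴹ B ∧ IsInfinite (sep B fun y => app c (upair x y) = emp)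
  · obtain ⟨A, hAW, hA, hrich⟩ := h
    -- The reservoir `B` is merely asserted to exist for `E`. It is never chosen along the
    -- construction.
    let G := sep (finpow W) fun E => (∀ x y, x ∈ᴹ E → y ∈ᴹ E → x ≠ y → app c (upair x y) = emp) ∧
      ∃ B, IsSubset B A ∧ IsInfinite B ∧ ∀ x y, x ∈ᴹ E → y ∈ᴹ B → app c (upair x y) = emp
    have mem_G : ∀ {E}, E ∈ᴹ G ↔ (IsSubset E W ∧ IsFinite E) ∧
        (∀ x y, x ∈ᴹ E → y ∈ᴹ E → x ≠ y → app c (upair x y) = emp) ∧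
        ∃ B, IsSubset B A ∧ IsInfinite B ∧ ∀ x y, x ∈ᴹ E → y ∈ᴹ B → app c (upair x y) = emp := by
      intro E
      rw [← mem_finpow]
      exact mem_sep
    obtain ⟨D, hD, hDinf, hDG⟩ := exists_infinite_of_extension (G := G) hW
      (mem_G.2 ⟨⟨fun x hx => (mem_emp hx).elim, finite_emp⟩, fun x y hx => (mem_emp hx).elim,
        A, subset_refl A, hA, fun x y hx => (mem_emp hx).elim⟩)
      (fun E hE => (mem_G.1 hE).1.1)
      (fun E F hE hF => by
        obtain ⟨⟨h1, h2⟩, h3, B, hB, hB', hEB⟩ := mem_G.1 hE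
        exact mem_G.2 ⟨⟨hF.trans h1, finite_subset h2 hF⟩,
          fun x y hx hy => h3 x y (hF x hx) (hF y hy), B, hB, hB',
          fun x y hx hy => hEB x y (hF x hx) hy⟩)
      (fun E hE => by
        obtain ⟨⟨h1, h2⟩, h3, B, hB, hB', hEB⟩ := mem_G.1 hE
        obtain ⟨x, hx, hx'⟩ := hrich (diff B E) (fun z hz => hB z (mem_diff.1 hz).1) (hB'.diff h2)
        obtain ⟨hxB, hxE⟩ := mem_diff.1 hx
        refine ⟨x, hAW x (hB x hxB), hxE, mem_G.2 ⟨⟨fun z hz => ?_, finite_ins x h2⟩, ?_,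
          sep (diff B E) fun y => app c (upair x y) = emp, fun z hz => ?_, hx', ?_⟩⟩
        · rcases mem_ins.1 hz with hz | rfl
          · exact h1 z hz
          · exact hAW z (hB z hxB)
        · intro y z hy hz hyz
          rcases mem_ins.1 hy with hy' | rfl <;> rcases mem_ins.1 hz with hz' | rfl
          · exact h3 y z hy' hz' hyz
          · exact hEB y z hy' hxB
          · rw [upair_comm]
            exact hEB z y hz' hxB
          · exact (hyz rfl).elim
        · exact hB z (mem_diff.1 (mem_sep.1 hz).1).1
        · intro y z hy hz
          obtain ⟨hz1, hz2⟩ := mem_sep.1 hz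
          rcases mem_ins.1 hy with hy | rfl
          · exact hEB y z hy (mem_diff.1 hz1).1
          · exact hz2)
    refine ⟨D, hD, hDinf.isInfinite, Or.inl fun x y hx hy hxy => ?_⟩
    exact (mem_G.1 (hDG (upair x y) (sub x y D hx hy) (finite_upair x y))).2.1 x y
      (mem_l x y) (mem_r x y) hxy
  · push Not at h
    obtain ⟨B, hB, hB', hfin⟩ := h W (subset_refl W) hinf
    have hfin : ∀ x, x ∈ᴹ B → IsFinite (sep B fun y => app c (upair x y) = emp) :=
      fun x hx => not_not.1 (hfin x hx)
    let G := sep (finpow B) fun E => ∀ x y, x ∈ᴹ E → y ∈ᴹ E → x ≠ y → app c (upair x y) ≠ emp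
    have mem_G : ∀ {E}, E ∈ᴹ G ↔ (IsSubset E B ∧ IsFinite E) ∧
        ∀ x y, x ∈ᴹ E → y ∈ᴹ E → x ≠ y → app c (upair x y) ≠ emp := by
      intro E
      rw [← mem_finpow]
      exact mem_sep
    obtain ⟨D, hD, hDinf, hDG⟩ := exists_infinite_of_extension (G := G) hW
      (mem_G.2 ⟨⟨fun x hx => (mem_emp hx).elim, finite_emp⟩, fun x y hx => (mem_emp hx).elim⟩)
      (fun E hE => (mem_G.1 hE).1.1.trans hB)
      (fun E F hE hF => by
        obtain ⟨⟨h1, h2⟩, h3⟩ := mem_G.1 hE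
        exact mem_G.2 ⟨⟨hF.trans h1, finite_subset h2 hF⟩,
          fun x y hx hy => h3 x y (hF x hx) (hF y hy)⟩)
      (fun E hE => by
        obtain ⟨⟨h1, h2⟩, h3⟩ := mem_G.1 hE
        have hU : IsFinite (sUnion (img E fun x => sep B fun y => app c (upair x y) = emp)) := by
          refine finite_sUnion (finite_img h2 _) fun z hz => ?_
          obtain ⟨x, hx, rfl⟩ := mem_img.1 hz
          exact hfin x (h1 x hx)
        obtain ⟨y, hy⟩ := ((hB'.diff h2).diff hU).exists_mem
        obtain ⟨hy, hyU⟩ := mem_diff.1 hy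
        obtain ⟨hyB, hyE⟩ := mem_diff.1 hy
        have hcol : ∀ x, x ∈ᴹ E → app c (upair x y) ≠ emp := fun x hx h =>
          hyU (mem_sUnion.2 ⟨_, mem_img.2 ⟨x, hx, rfl⟩, mem_sep.2 ⟨hyB, h⟩⟩)
        refine ⟨y, hB y hyB, hyE, mem_G.2 ⟨⟨fun z hz => ?_, finite_ins y h2⟩, ?_⟩⟩
        · rcases mem_ins.1 hz with hz | rfl
          · exact h1 z hz
          · exact hyB
        · intro x z hx hz hxz
          rcases mem_ins.1 hx with hx' | rfl <;> rcases mem_ins.1 hz with hz' | rfl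
          · exact h3 x z hx' hz' hxz
          · exact hcol x hx'
          · rw [upair_comm]
            exact hcol z hz'
          · exact (hxz rfl).elim)
    refine ⟨D, hD, hDinf.isInfinite, Or.inr fun x y hx hy hxy => ?_⟩
    exact (mem_G.1 (hDG (upair x y) (sub x y D hx hy) (finite_upair x y))).2 x y
      (mem_l x y) (mem_r x y) hxy

theorem isPairSet_iff {Q X : M} : IsPairSet Q X ↔
    ∀ s, s ∈ᴹ Q ↔ ∃ x y, x ∈ᴹ X ∧ y ∈ᴹ X ∧ x ≠ y ∧ s = upair x y := by
  simp only [IsPairSet, isUnorderedPair_iff]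

theorem rt_of_finEqDFin (h : FinEqDFin M) : RT M := by
  intro X hX Q t c hQ ht hc
  obtain ⟨W, f, hWX, hW, hf⟩ := (h X hX).exists_countable
  obtain ⟨D, hDW, hD, hhom⟩ :=
    exists_homogeneous (c := c) (choosable_of_injection hf choosable_omg) hW
  rw [isPairSet_iff] at hQ
  have hDX := hDW.trans hWX
  have mem_R : ∀ s, s ∈ᴹ sep Q (fun s => IsSubset s D) ↔
      ∃ x y, x ∈ᴹ D ∧ y ∈ᴹ D ∧ x ≠ y ∧ s = upair x y := by
    intro s
    rw [mem_sep, hQ]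
    constructor
    · rintro ⟨⟨x, y, -, -, hxy, rfl⟩, hs⟩
      exact ⟨x, y, hs x (by simp), hs y (by simp), hxy, rfl⟩
    · rintro ⟨x, y, hx, hy, hxy, rfl⟩
      refine ⟨⟨x, y, hDX x hx, hDX y hy, hxy, rfl⟩, fun z hz => ?_⟩
      rcases mem_upair.1 hz with rfl | rfl <;> assumption
  refine ⟨D, _, hDX, hD, isPairSet_iff.2 mem_R, ?_⟩
  have hval : ∀ x y, x ∈ᴹ D → y ∈ᴹ D → x ≠ y → opair (upair x y) (app c (upair x y)) ∈ᴹ c ∧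
      (app c (upair x y) = emp ∨ app c (upair x y) = ins emp emp) := by
    intro x y hx hy hxy
    have hq : upair x y ∈ᴹ Q := (hQ _).2 ⟨x, y, hDX x hx, hDX y hy, hxy, rfl⟩
    exact ⟨hc.maps_app hq, (isTwo_mem ht).1 (hc.app_mem hq)⟩
  rcases hhom with h0 | h1
  · refine ⟨emp, fun s hs => ?_⟩
    obtain ⟨x, y, hx, hy, hxy, rfl⟩ := (mem_R s).1 hs
    rw [maps_iff, ← h0 x y hx hy hxy]
    exact (hval x y hx hy hxy).1
  · refine ⟨ins emp emp, fun s hs => ?_⟩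
    obtain ⟨x, y, hx, hy, hxy, rfl⟩ := (mem_R s).1 hs
    rw [maps_iff, ← (hval x y hx hy hxy).2.resolve_left (h1 x y hx hy hxy)]
    exact (hval x y hx hy hxy).1

end Ramsey

/-! ### Hindman's theorem, by Baumgartner's largeness argument -/

section Hindman

variable {M : Type u} [setLang.Structure M] [hM : ZF M]

/-- `x` and `y` are disjoint. -/
def Disj (x y : M) : Prop := ∀ z, z ∈ᴹ x → ¬ z ∈ᴹ y

instance DefP.disj (f g : (ℕ → M) → M) [DefF f] [DefF g] : DefP (fun w => Disj (f w) (g w)) :=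
  DefP.comp₂ (R := Disj) (by unfold Disj; infer_instance) f g

theorem Disj.symm {x y : M} (h : Disj x y) : Disj y x := fun z hy hx => h z hx hy

theorem disj_un {x y z : M} : Disj x (un y z) ↔ Disj x y ∧ Disj x z := by
  simp only [Disj, mem_un, not_or]
  exact ⟨fun h => ⟨fun t ht => (h t ht).1, fun t ht => (h t ht).2⟩,
    fun h t ht => ⟨h.1 t ht, h.2 t ht⟩⟩

theorem un_comm (x y : M) : un x y = un y x := ext fun z => by simp [or_comm]

theorem un_assoc (x y z : M) : un (un x y) z = un x (un y z) := ext fun t => by simp [or_assoc]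

instance DefP.isPairwiseDisjoint (f : (ℕ → M) → M) [DefF f] :
    DefP (fun w => IsPairwiseDisjoint (f w)) :=
  DefP.comp₁ (R := IsPairwiseDisjoint) (by unfold IsPairwiseDisjoint; infer_instance) f

theorem IsPairwiseDisjoint.mono {E F : M} (hE : IsPairwiseDisjoint E) (h : IsSubset F E) :
    IsPairwiseDisjoint F := fun a b ha hb => hE a b (h a ha) (h b hb)

theorem IsPairwiseDisjoint.disj_sUnion {E F a : M} (hE : IsPairwiseDisjoint E)
    (h : IsSubset F E) (ha : a ∈ᴹ E) (haF : ¬ a ∈ᴹ F) : Disj a (sUnion F) := by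
  intro z hz hz'
  obtain ⟨b, hb, hzb⟩ := mem_sUnion.1 hz'
  refine hE a b ha (h b hb) ?_ z ⟨hz, hzb⟩
  rintro rfl
  exact haF hb

theorem IsPairwiseDisjoint.ins {E x : M} (hE : IsPairwiseDisjoint E) (hx : Disj x (sUnion E)) :
    IsPairwiseDisjoint (ins x E) := by
  intro a b ha hb hab z hz
  rcases mem_ins.1 ha with ha' | rfl <;> rcases mem_ins.1 hb with hb' | rfl
  · exact hE a b ha' hb' hab z hz
  · exact hx z hz.2 (mem_sUnion.2 ⟨a, ha', hz.1⟩)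
  · exact hx z hz.1 (mem_sUnion.2 ⟨b, hb', hz.2⟩)
  · exact hab rfl

/-- The set of unions of nonempty finite subfamilies of `E`. -/
noncomputable def FU (E : M) : M := img (sep (finpow E) fun F => F ≠ emp) fun F => sUnion F

theorem mem_FU {E u : M} :
    u ∈ᴹ FU E ↔ ∃ F, IsSubset F E ∧ IsFinite F ∧ F ≠ emp ∧ u = sUnion F := by
  simp only [FU, mem_img, mem_sep, mem_finpow, and_assoc]

instance DefF.FU (f : (ℕ → M) → M) [DefF f] : DefF (fun w => FU (f w)) :=
  DefF.comp₁ (F := SetModel.FU) (by unfold SetModel.FU; infer_instance) f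

theorem finite_FU {E : M} (hE : IsFinite E) : IsFinite (FU E) :=
  finite_img (finite_subset (finite_pow hE) fun _ hF =>
    mem_pow.2 (mem_finpow.1 (mem_sep.1 hF).1).1) _

theorem FU_mono {E F : M} (h : IsSubset F E) : IsSubset (FU F) (FU E) := fun u hu => by
  obtain ⟨K, hK, hK'⟩ := mem_FU.1 hu
  exact mem_FU.2 ⟨K, hK.trans h, hK'⟩

theorem sUnion_eq_un_diff {F x : M} (hx : x ∈ᴹ F) :
    sUnion F = un x (sUnion (diff F (sing x))) := by
  conv_lhs => rw [← ins_diff_sing hx, sUnion_ins, un_comm]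

theorem diff_sing_subset {E F x : M} (h : IsSubset F (ins x E)) :
    IsSubset (diff F (sing x)) E := fun z hz => by
  simp only [mem_diff, mem_sing] at hz
  exact (mem_ins.1 (h z hz.1)).resolve_right hz.2

theorem subset_of_not_mem {E F x : M} (h : IsSubset F (ins x E)) (hx : ¬ x ∈ᴹ F) :
    IsSubset F E := fun z hz => by
  refine (mem_ins.1 (h z hz)).resolve_right ?_
  rintro rfl
  exact hx hz

theorem mem_FU_ins {x E u : M} (hu : u ∈ᴹ FU (ins x E)) :
    u ∈ᴹ FU E ∨ u = x ∨ ∃ v, v ∈ᴹ FU E ∧ u = un x v := by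
  obtain ⟨F, hF, hfin, hne, rfl⟩ := mem_FU.1 hu
  by_cases hx : x ∈ᴹ F
  · right
    rw [sUnion_eq_un_diff hx]
    by_cases he : diff F (sing x) = emp
    · left
      rw [he, sUnion_emp, un_emp]
    · right
      exact ⟨_, mem_FU.2 ⟨_, diff_sing_subset hF, finite_subset hfin fun z hz => (mem_diff.1 hz).1,
        he, rfl⟩, rfl⟩
  · exact Or.inl (mem_FU.2 ⟨F, subset_of_not_mem hF hx, hfin, hne, rfl⟩)

theorem FU_emp {u : M} : ¬ u ∈ᴹ FU emp := fun hu => by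
  obtain ⟨F, hF, -, hne, -⟩ := mem_FU.1 hu
  exact hne (isEmptySet_iff.1 fun z hz => mem_emp (hF z hz))

theorem mem_FU_of_mem {E x : M} (hx : x ∈ᴹ E) : x ∈ᴹ FU E := by
  refine mem_FU.2 ⟨sing x, fun z hz => ?_, finite_sing x, ne_emp_iff.2 ⟨x, by simp⟩,
    (sUnion_sing x).symm⟩
  rw [mem_sing] at hz
  rwa [hz]

theorem sUnion_un (E F : M) : sUnion (un E F) = un (sUnion E) (sUnion F) := ext fun z => by
  simp only [mem_sUnion, mem_un, or_and_right, exists_or]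

/-- A family of nonempty finite subsets of `W` that is closed under disjoint unions and has
members disjoint from any given finite set. -/
def IsUPS (W C : M) : Prop :=
  IsSubset C (finpow W) ∧ ¬ emp ∈ᴹ C ∧
    (∀ a b, a ∈ᴹ C → b ∈ᴹ C → Disj a b → un a b ∈ᴹ C) ∧
    ∀ a, IsFinite a → ∃ d, d ∈ᴹ C ∧ Disj d a

instance DefP.isUPS (f g : (ℕ → M) → M) [DefF f] [DefF g] : DefP (fun w => IsUPS (f w) (g w)) :=
  DefP.comp₂ (R := IsUPS) (by unfold IsUPS; infer_instance) f g

/-- `X` meets every subfamily of `C` that is closed and unbounded in the sense of `IsUPS`. -/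
def Large (W X C : M) : Prop :=
  ∀ C', IsSubset C' C → IsUPS W C' → ∃ x, x ∈ᴹ C' ∧ x ∈ᴹ X

instance DefP.large (f g h : (ℕ → M) → M) [DefF f] [DefF g] [DefF h] :
    DefP (fun w => Large (f w) (g w) (h w)) :=
  DefP.comp₃ (R := Large) (by unfold Large; infer_instance) f g h

variable {W : M}

theorem Large.mono {X Y C : M} (h : Large W X C) (hXY : IsSubset X Y) : Large W Y C :=
  fun C' h1 h2 => by
    obtain ⟨x, hx, hx'⟩ := h C' h1 h2
    exact ⟨x, hx, hXY x hx'⟩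

theorem Large.subset {X C C' : M} (h : Large W X C) (hC : IsSubset C' C) : Large W X C' :=
  fun C'' h1 h2 => h C'' (h1.trans hC) h2

/-- The members of `C` that are disjoint from `a`. -/
noncomputable def avoid (C a : M) : M := sep C fun x => Disj x a

theorem mem_avoid {C a x : M} : x ∈ᴹ avoid C a ↔ x ∈ᴹ C ∧ Disj x a := mem_sep

theorem avoid_subset {C a : M} : IsSubset (avoid C a) C := fun _ hx => (mem_avoid.1 hx).1

theorem IsUPS.avoid {C a : M} (hC : IsUPS W C) (ha : IsFinite a) : IsUPS W (avoid C a) := by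
  obtain ⟨h1, h2, h3, h4⟩ := hC
  refine ⟨avoid_subset.trans h1, fun h => h2 (avoid_subset _ h), fun x y hx hy hxy => ?_,
    fun b hb => ?_⟩
  · obtain ⟨hx, hxa⟩ := mem_avoid.1 hx
    obtain ⟨hy, hya⟩ := mem_avoid.1 hy
    exact mem_avoid.2 ⟨h3 x y hx hy hxy, (disj_un.2 ⟨hxa.symm, hya.symm⟩).symm⟩
  · obtain ⟨d, hd, hd'⟩ := h4 (un a b) (finite_un ha hb)
    obtain ⟨hda, hdb⟩ := disj_un.1 hd'
    exact ⟨d, mem_avoid.2 ⟨hd, hda⟩, hdb⟩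

theorem IsUPS.finite_of_mem {C x : M} (hC : IsUPS W C) (hx : x ∈ᴹ C) : IsFinite x :=
  (mem_finpow.1 (hC.1 x hx)).2

theorem IsUPS.not_mem_of_disj {C E x : M} (hC : IsUPS W C) (hx : x ∈ᴹ C)
    (h : Disj x (sUnion E)) : ¬ x ∈ᴹ E := fun hxE => by
  obtain ⟨z, hz⟩ := ne_emp_iff.1 (show x ≠ emp by rintro rfl; exact hC.2.1 hx)
  exact h z hz (mem_sUnion.2 ⟨x, hxE, hz⟩)

theorem IsUPS.finite_sUnion {C E : M} (hC : IsUPS W C) (hE : IsFinite E) (h : IsSubset E C) :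
    IsFinite (sUnion E) :=
  SetModel.finite_sUnion hE fun x hx => hC.finite_of_mem (h x hx)

/-- A failure of largeness of `X` is witnessed by a subfamily that `X` misses; inside it, all the
meeting must be done by `Y`. -/
theorem large_un {X Y C : M} (h : Large W (un X Y) C) :
    Large W X C ∨ ∃ C', IsSubset C' C ∧ IsUPS W C' ∧ Large W Y C' := by
  by_cases hX : Large W X C
  · exact Or.inl hX
  right
  unfold Large at hX
  push Not at hX
  obtain ⟨C', h1, h2, h3⟩ := hX
  refine ⟨C', h1, h2, fun C'' h4 h5 => ?_⟩
  obtain ⟨x, hx, hx'⟩ := h C'' (h4.trans h1) h5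
  exact ⟨x, hx, (mem_un.1 hx').resolve_left (h3 x (h4 x hx))⟩

theorem large_sUnion {A C : M} (hA : IsFinite A) (hC : IsUPS W C) (h : Large W (sUnion A) C) :
    ∃ Y C', Y ∈ᴹ A ∧ IsSubset C' C ∧ IsUPS W C' ∧ Large W Y C' := by
  refine finite_induction (fun A => Large W (sUnion A) C →
    ∃ Y C', Y ∈ᴹ A ∧ IsSubset C' C ∧ IsUPS W C' ∧ Large W Y C') ?_ ?_ A hA h
  · intro h
    obtain ⟨x, -, hx⟩ := h C (subset_refl C) hC
    rw [sUnion_emp] at hx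
    exact (mem_emp hx).elim
  · intro a s _ _ ih h
    rw [sUnion_ins] at h
    rcases large_un h with h | ⟨C', h1, h2, h3⟩
    · obtain ⟨Y, C', hY, h'⟩ := ih h
      exact ⟨Y, C', mem_ins.2 (Or.inl hY), h'⟩
    · exact ⟨a, C', by simp, h1, h2, h3⟩

theorem IsUPS.FU_subset {C E : M} (hC : IsUPS W C) (hE : IsPairwiseDisjoint E)
    (h : IsSubset E C) : IsSubset (FU E) C := by
  intro u hu
  obtain ⟨F, hF, hfin, hne, rfl⟩ := mem_FU.1 hu
  refine (finite_induction (fun F => IsSubset F E → F = emp ∨ sUnion F ∈ᴹ C) ?_ ?_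
    F hfin hF).resolve_left hne
  · exact fun _ => Or.inl rfl
  · intro a s _ has ih hs
    right
    have hsE : IsSubset s E := fun z hz => hs z (mem_ins.2 (Or.inl hz))
    have ha : a ∈ᴹ E := hs a (by simp)
    rw [sUnion_ins]
    rcases ih hsE with rfl | h'
    · rw [sUnion_emp, un_comm, un_emp]
      exact h a ha
    · exact hC.2.2.1 _ _ h' (h a ha) (hE.disj_sUnion hsE ha has).symm

/-- Each point of `a` lies in at most one member of `D`, so the members that meet `a` are covered by
an image of `a`. -/
theorem finite_meeting {D a : M} (hD : IsPairwiseDisjoint D) (ha : IsFinite a) :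
    IsFinite (sep D fun d => ¬ Disj d a) := by
  refine finite_subset (finite_img ha fun z => sUnion (sep D fun d => z ∈ᴹ d)) fun d hd => ?_
  obtain ⟨hd, hda⟩ := mem_sep.1 hd
  unfold Disj at hda
  push Not at hda
  obtain ⟨z, hzd, hza⟩ := hda
  refine mem_img.2 ⟨z, hza, (sUnion_sep_eq hd hzd fun e he hze => ?_).symm⟩
  by_contra hne
  exact hD e d he hd hne z ⟨hze, hzd⟩

theorem exists_disj {D a : M} (hD : IsPairwiseDisjoint D) (hinf : IsInfinite D)
    (ha : IsFinite a) : ∃ d, d ∈ᴹ D ∧ Disj d a := by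
  obtain ⟨d, hd⟩ := (hinf.diff (finite_meeting hD ha)).exists_mem
  obtain ⟨hd, hd'⟩ := mem_diff.1 hd
  refine ⟨d, hd, ?_⟩
  by_contra h
  exact hd' (mem_sep.2 ⟨hd, h⟩)

theorem isUPS_FU {C D : M} (hC : IsUPS W C) (hD : IsPairwiseDisjoint D) (hinf : IsInfinite D)
    (hDC : IsSubset D C) : IsUPS W (FU D) := by
  have hsub := hC.FU_subset hD hDC
  refine ⟨hsub.trans hC.1, fun h => hC.2.1 (hsub _ h), fun a b ha hb _ => ?_, fun a ha => ?_⟩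
  · obtain ⟨F, hF, hfin, hne, rfl⟩ := mem_FU.1 ha
    obtain ⟨F', hF', hfin', hne', rfl⟩ := mem_FU.1 hb
    rw [← sUnion_un]
    refine mem_FU.2 ⟨_, fun z hz => ?_, finite_un hfin hfin', ?_, rfl⟩
    · rcases mem_un.1 hz with hz | hz
      · exact hF z hz
      · exact hF' z hz
    · obtain ⟨x, hx⟩ := ne_emp_iff.1 hne
      exact ne_emp_iff.2 ⟨x, mem_un.2 (Or.inl hx)⟩
  · obtain ⟨d, hd, hda⟩ := exists_disj hD hinf ha
    exact ⟨d, mem_FU_of_mem hd, hda⟩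

theorem isPairwiseDisjoint_of_finite {D : M}
    (h : ∀ F, IsSubset F D → IsFinite F → IsPairwiseDisjoint F) : IsPairwiseDisjoint D := by
  intro a b ha hb
  refine h (upair a b) (fun z hz => ?_) (finite_upair a b) a b (by simp) (by simp)
  rcases mem_upair.1 hz with rfl | rfl <;> assumption

theorem isPairwiseDisjoint_emp : IsPairwiseDisjoint (emp : M) := fun _ _ ha => (mem_emp ha).elim

theorem emp_subset (X : M) : IsSubset emp X := fun _ hx => (mem_emp hx).elim

theorem ins_subset {x E X : M} (hx : x ∈ᴹ X) (hE : IsSubset E X) : IsSubset (ins x E) X :=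
  fun z hz => by
    rcases mem_ins.1 hz with hz | rfl
    · exact hE z hz
    · exact hx

/-- If `X` is large for `C`, then every member of `C` beyond some finite part of `C` can be
brought into `X` by adding a union of elements of this finite part. -/
theorem Large.exists_finite {X C : M} (hW : Choosable (finpow W)) (hC : IsUPS W C)
    (h : Large W X C) : ∃ E, IsFinite E ∧ IsSubset E C ∧ IsPairwiseDisjoint E ∧
      ∀ x, x ∈ᴹ C → Disj x (sUnion E) → ∃ e, e ∈ᴹ FU E ∧ un x e ∈ᴹ X := by
  -- If no finite `E` works, a bad `x` can be adjoined again and again, giving an infinite disjoint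
  -- `D` none of whose unions of two or more members lies in `X`. Those unions form a family `C'` as
  -- in `IsUPS`, which contradicts largeness.
  by_contra hcon
  push Not at hcon
  let G := sep (finpow C) fun E => IsPairwiseDisjoint E ∧
    ∀ F, IsSubset F E → (∃ a b, a ∈ᴹ F ∧ b ∈ᴹ F ∧ a ≠ b) → ¬ sUnion F ∈ᴹ X
  have mem_G : ∀ {E}, E ∈ᴹ G ↔ (IsSubset E C ∧ IsFinite E) ∧ IsPairwiseDisjoint E ∧
      ∀ F, IsSubset F E → (∃ a b, a ∈ᴹ F ∧ b ∈ᴹ F ∧ a ≠ b) → ¬ sUnion F ∈ᴹ X := by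
    intro E
    rw [← mem_finpow]
    exact mem_sep
  obtain ⟨D, hDW, hDinf, hDG⟩ := exists_infinite_of_extension (G := G) hW
    (mem_G.2 ⟨⟨emp_subset C, finite_emp⟩, isPairwiseDisjoint_emp, fun F hF h => by
      obtain ⟨a, b, ha, -⟩ := h
      exact (mem_emp (hF a ha)).elim⟩)
    (fun E hE => (mem_G.1 hE).1.1.trans hC.1)
    (fun E F hE hF => by
      obtain ⟨⟨h1, h2⟩, h3, h4⟩ := mem_G.1 hE
      exact mem_G.2 ⟨⟨hF.trans h1, finite_subset h2 hF⟩, h3.mono hF,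
        fun K hK => h4 K (hK.trans hF)⟩)
    (fun E hE => by
      obtain ⟨⟨h1, h2⟩, h3, h4⟩ := mem_G.1 hE
      obtain ⟨x, hx, hxE, hx'⟩ := hcon E h2 h1 h3
      refine ⟨x, hC.1 x hx, hC.not_mem_of_disj hx hxE, mem_G.2
        ⟨⟨ins_subset hx h1, finite_ins x h2⟩, h3.ins hxE, fun F hF hab => ?_⟩⟩
      by_cases hxF : x ∈ᴹ F
      · rw [sUnion_eq_un_diff hxF]
        refine hx' _ (mem_FU.2 ⟨_, diff_sing_subset hF,
          finite_subset h2 (diff_sing_subset hF), ?_, rfl⟩)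
        obtain ⟨a, b, ha, hb, hab⟩ := hab
        rw [ne_emp_iff]
        by_cases hax : a = x
        · exact ⟨b, by simpa using ⟨hb, fun hbx => hab (hax.trans hbx.symm)⟩⟩
        · exact ⟨a, by simpa using ⟨ha, hax⟩⟩
      · exact h4 F (subset_of_not_mem hF hxF) hab)
  have hDpw : IsPairwiseDisjoint D :=
    isPairwiseDisjoint_of_finite fun F hF hfin => (mem_G.1 (hDG F hF hfin)).2.1
  have hDC : IsSubset D C := fun d hd => by
    refine (mem_G.1 (hDG (sing d) (fun z hz => ?_) (finite_sing d))).1.1 d (by simp)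
    rw [mem_sing] at hz
    rwa [hz]
  let C' := img (sep (finpow D) fun F => ∃ a b, a ∈ᴹ F ∧ b ∈ᴹ F ∧ a ≠ b) fun F => sUnion F
  have mem_C' : ∀ {u}, u ∈ᴹ C' ↔ ∃ F, ((IsSubset F D ∧ IsFinite F) ∧
      ∃ a b, a ∈ᴹ F ∧ b ∈ᴹ F ∧ a ≠ b) ∧ u = sUnion F := by
    intro u
    simp only [C', mem_img, mem_sep, mem_finpow]
  have hsub : IsSubset C' C := fun u hu => by
    obtain ⟨F, ⟨⟨hF, hfin⟩, a, b, ha, -⟩, rfl⟩ := mem_C'.1 hu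
    exact hC.FU_subset hDpw hDC _ (mem_FU.2 ⟨F, hF, hfin, ne_emp_iff.2 ⟨a, ha⟩, rfl⟩)
  have hC' : IsUPS W C' := by
    refine ⟨hsub.trans hC.1, fun h => hC.2.1 (hsub _ h), fun x y hx hy _ => ?_, fun a ha => ?_⟩
    · obtain ⟨F, ⟨⟨hF, hfin⟩, a, b, ha, hb, hab⟩, rfl⟩ := mem_C'.1 hx
      obtain ⟨F', ⟨⟨hF', hfin'⟩, -⟩, rfl⟩ := mem_C'.1 hy
      rw [← sUnion_un]
      refine mem_C'.2 ⟨_, ⟨⟨fun z hz => ?_, finite_un hfin hfin'⟩, a, b, mem_un.2 (Or.inl ha),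
        mem_un.2 (Or.inl hb), hab⟩, rfl⟩
      rcases mem_un.1 hz with hz | hz
      · exact hF z hz
      · exact hF' z hz
    · obtain ⟨d, hd, hda⟩ := exists_disj hDpw hDinf.isInfinite ha
      obtain ⟨e, he, hea⟩ := exists_disj hDpw hDinf.isInfinite
        (finite_un ha (hC.finite_of_mem (hDC d hd)))
      obtain ⟨hea, hed⟩ := disj_un.1 hea
      have hne : d ≠ e := by
        rintro rfl
        obtain ⟨z, hz⟩ := ne_emp_iff.1 (show d ≠ emp by rintro rfl; exact hC.2.1 (hDC _ hd))
        exact hed z hz hz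
      refine ⟨un d e, mem_C'.2 ⟨upair d e, ⟨⟨fun z hz => ?_, finite_upair d e⟩, d, e, by simp,
        by simp, hne⟩, rfl⟩, (disj_un.2 ⟨hda.symm, hea.symm⟩).symm⟩
      rcases mem_upair.1 hz with rfl | rfl <;> assumption
  obtain ⟨x, hx, hxX⟩ := h C' hsub hC'
  obtain ⟨F, ⟨⟨hF, hfin⟩, hab⟩, rfl⟩ := mem_C'.1 hx
  exact (mem_G.1 (hDG F hF hfin)).2.2 F (subset_refl F) hab hxX

/-- Pigeonhole over the finite set `FU E` from `Large.exists_finite`: the shifts of `X` by its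
elements together cover the part of `X` in `C` away from `E`, so one of them is large for a
subfamily. The `e` found need not lie in `X`; `Large.exists_shift_mem` repairs this. -/
theorem Large.exists_shift {X C : M} (hW : Choosable (finpow W)) (hC : IsUPS W C)
    (h : Large W X C) : ∃ e C', e ∈ᴹ C ∧ IsSubset C' C ∧ IsUPS W C' ∧
      Large W (sep X fun x => un x e ∈ᴹ X) C' := by
  obtain ⟨E, hfin, hEC, hE, hE'⟩ := h.exists_finite hW hC
  have hC₁ := hC.avoid (hC.finite_sUnion hfin hEC)
  obtain ⟨Y, C', hY, h1, h2, h3⟩ := large_sUnion (W := W)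
    (A := img (FU E) fun e => sep X fun x => un x e ∈ᴹ X) (finite_img (finite_FU hfin) _) hC₁
    (fun C' h1 h2 => by
      obtain ⟨x, hx, hxX⟩ := h C' (h1.trans avoid_subset) h2
      obtain ⟨hxC, hxE⟩ := mem_avoid.1 (h1 x hx)
      obtain ⟨e, he, hxe⟩ := hE' x hxC hxE
      exact ⟨x, hx, mem_sUnion.2 ⟨_, mem_img.2 ⟨e, he, rfl⟩, mem_sep.2 ⟨hxX, hxe⟩⟩⟩)
  obtain ⟨e, he, rfl⟩ := mem_img.1 hY
  exact ⟨e, C', hC.FU_subset hE hEC e he, h1.trans avoid_subset, h2, h3⟩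

/-- The members of `X` that stay in `X` when a union of elements of `E` is added. -/
noncomputable def res (X E : M) : M := sep X fun x => ∀ u, u ∈ᴹ FU E → un x u ∈ᴹ X

theorem mem_res {X E x : M} : x ∈ᴹ res X E ↔ x ∈ᴹ X ∧ ∀ u, u ∈ᴹ FU E → un x u ∈ᴹ X := mem_sep

instance DefF.res (f g : (ℕ → M) → M) [DefF f] [DefF g] : DefF (fun w => res (f w) (g w)) :=
  DefF.comp₂ (F := SetModel.res) (by unfold SetModel.res; infer_instance) f g

theorem subset_res_emp (X : M) : IsSubset X (res X emp) := fun _ hx =>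
  mem_res.2 ⟨hx, fun _ hu => (FU_emp hu).elim⟩

theorem res_anti {X E F : M} (h : IsSubset F E) : IsSubset (res X E) (res X F) := fun x hx => by
  obtain ⟨h1, h2⟩ := mem_res.1 hx
  exact mem_res.2 ⟨h1, fun u hu => h2 u (FU_mono h u hu)⟩

/-- The inductive step for `res`: a new finite union is `e` itself or `e ∪ v` with `v` an old one,
and the latter is absorbed because the shifted point lies in `res X E` again. -/
theorem shift_res_subset (X E e : M) :
    IsSubset (sep (res X E) fun x => un x e ∈ᴹ res X E) (res X (ins e E)) := fun x hx => by
  obtain ⟨h1, h2⟩ := mem_sep.1 hx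
  obtain ⟨h1, h3⟩ := mem_res.1 h1
  obtain ⟨h2, h4⟩ := mem_res.1 h2
  refine mem_res.2 ⟨h1, fun u hu => ?_⟩
  rcases mem_FU_ins hu with hu | rfl | ⟨v, hv, rfl⟩
  · exact h3 u hu
  · exact h2
  · rw [← un_assoc]
    exact h4 v hv

/-- Iterated shifts give an infinite disjoint `D` such that `res X F` remains large for some
subfamily, for every finite `F ⊆ D`. As `FU D` satisfies `IsUPS`, `X` meets it in some `⋃ F`, and
this union is a shift that belongs to `X`. -/
theorem Large.exists_shift_mem {X C : M} (hW : Choosable (finpow W)) (hC : IsUPS W C)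
    (h : Large W X C) : ∃ d C', d ∈ᴹ C ∧ d ∈ᴹ X ∧ IsSubset C' C ∧ IsUPS W C' ∧
      Large W (sep X fun x => un x d ∈ᴹ X) C' := by
  let G := sep (finpow C) fun E => IsPairwiseDisjoint E ∧
    ∃ C', IsSubset C' C ∧ IsUPS W C' ∧ Large W (res X E) C'
  have mem_G : ∀ {E}, E ∈ᴹ G ↔ (IsSubset E C ∧ IsFinite E) ∧ IsPairwiseDisjoint E ∧
      ∃ C', IsSubset C' C ∧ IsUPS W C' ∧ Large W (res X E) C' := by
    intro E
    rw [← mem_finpow]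
    exact mem_sep
  obtain ⟨D, hDW, hDinf, hDG⟩ := exists_infinite_of_extension (G := G) hW
    (mem_G.2 ⟨⟨emp_subset C, finite_emp⟩, isPairwiseDisjoint_emp, C, subset_refl C, hC,
      h.mono (subset_res_emp X)⟩)
    (fun E hE => (mem_G.1 hE).1.1.trans hC.1)
    (fun E F hE hF => by
      obtain ⟨⟨h1, h2⟩, h3, C', h4, h5, h6⟩ := mem_G.1 hE
      exact mem_G.2 ⟨⟨hF.trans h1, finite_subset h2 hF⟩, h3.mono hF, C', h4, h5,
        h6.mono (res_anti hF)⟩)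
    (fun E hE => by
      obtain ⟨⟨h1, h2⟩, h3, C', h4, h5, h6⟩ := mem_G.1 hE
      obtain ⟨e, C'', he, h7, h8, h9⟩ := (h6.subset avoid_subset).exists_shift hW
        (h5.avoid (hC.finite_sUnion h2 h1))
      obtain ⟨he, heE⟩ := mem_avoid.1 he
      have heC := h4 e he
      exact ⟨e, hC.1 e heC, hC.not_mem_of_disj heC heE, mem_G.2
        ⟨⟨ins_subset heC h1, finite_ins e h2⟩, h3.ins heE, C'',
          h7.trans (avoid_subset.trans h4), h8, h9.mono (shift_res_subset X E e)⟩⟩)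
  have hDpw : IsPairwiseDisjoint D :=
    isPairwiseDisjoint_of_finite fun F hF hfin => (mem_G.1 (hDG F hF hfin)).2.1
  have hDC : IsSubset D C := fun d hd => by
    refine (mem_G.1 (hDG (sing d) (fun z hz => ?_) (finite_sing d))).1.1 d (by simp)
    rw [mem_sing] at hz
    rwa [hz]
  have hsub := hC.FU_subset hDpw hDC
  obtain ⟨d, hd, hdX⟩ := h (FU D) hsub (isUPS_FU hC hDpw hDinf.isInfinite hDC)
  obtain ⟨F, hF, hfin, hne, rfl⟩ := mem_FU.1 hd
  obtain ⟨-, -, C', h1, h2, h3⟩ := mem_G.1 (hDG F hF hfin)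
  refine ⟨_, C', hsub _ hd, hdX, h1, h2, h3.mono fun x hx => ?_⟩
  obtain ⟨hx, hx'⟩ := mem_res.1 hx
  exact mem_sep.2 ⟨hx, hx' _ (mem_FU.2 ⟨F, subset_refl F, hfin, hne, rfl⟩)⟩

/-- The same iteration as before, but each new `d` now lies in `res X E`, so all finite unions
remain in `X`. Choosing `d` away from `⋃ E` keeps the family disjoint. -/
theorem Large.exists_FU_subset {X C : M} (hW : Choosable (finpow W)) (hC : IsUPS W C)
    (h : Large W X C) : ∃ D, IsSubset D C ∧ IsInfinite D ∧ IsPairwiseDisjoint D ∧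
      IsSubset (FU D) X := by
  let G := sep (finpow C) fun E => IsPairwiseDisjoint E ∧ IsSubset (FU E) X ∧
    ∃ C', IsSubset C' C ∧ IsUPS W C' ∧ Large W (res X E) C'
  have mem_G : ∀ {E}, E ∈ᴹ G ↔ (IsSubset E C ∧ IsFinite E) ∧ IsPairwiseDisjoint E ∧
      IsSubset (FU E) X ∧ ∃ C', IsSubset C' C ∧ IsUPS W C' ∧ Large W (res X E) C' := by
    intro E
    rw [← mem_finpow]
    exact mem_sep
  obtain ⟨D, hDW, hDinf, hDG⟩ := exists_infinite_of_extension (G := G) hW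
    (mem_G.2 ⟨⟨emp_subset C, finite_emp⟩, isPairwiseDisjoint_emp, fun _ hu => (FU_emp hu).elim,
      C, subset_refl C, hC, h.mono (subset_res_emp X)⟩)
    (fun E hE => (mem_G.1 hE).1.1.trans hC.1)
    (fun E F hE hF => by
      obtain ⟨⟨h1, h2⟩, h3, h0, C', h4, h5, h6⟩ := mem_G.1 hE
      exact mem_G.2 ⟨⟨hF.trans h1, finite_subset h2 hF⟩, h3.mono hF, (FU_mono hF).trans h0,
        C', h4, h5, h6.mono (res_anti hF)⟩)
    (fun E hE => by
      obtain ⟨⟨h1, h2⟩, h3, h0, C', h4, h5, h6⟩ := mem_G.1 hE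
      obtain ⟨d, C'', hd, hdX, h7, h8, h9⟩ := (h6.subset avoid_subset).exists_shift_mem hW
        (h5.avoid (hC.finite_sUnion h2 h1))
      obtain ⟨hd, hdE⟩ := mem_avoid.1 hd
      have hdC := h4 d hd
      obtain ⟨hdX, hdX'⟩ := mem_res.1 hdX
      refine ⟨d, hC.1 d hdC, hC.not_mem_of_disj hdC hdE, mem_G.2
        ⟨⟨ins_subset hdC h1, finite_ins d h2⟩, h3.ins hdE, fun u hu => ?_, C'',
          h7.trans (avoid_subset.trans h4), h8, h9.mono (shift_res_subset X E d)⟩⟩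
      rcases mem_FU_ins hu with hu | rfl | ⟨v, hv, rfl⟩
      · exact h0 u hu
      · exact hdX
      · exact hdX' v hv)
  refine ⟨D, fun d hd => ?_, hDinf.isInfinite, isPairwiseDisjoint_of_finite fun F hF hfin =>
    (mem_G.1 (hDG F hF hfin)).2.1, fun u hu => ?_⟩
  · refine (mem_G.1 (hDG (sing d) (fun z hz => ?_) (finite_sing d))).1.1 d (by simp)
    rw [mem_sing] at hz
    rwa [hz]
  · obtain ⟨F, hF, hfin, hne, rfl⟩ := mem_FU.1 hu
    exact (mem_G.1 (hDG F hF hfin)).2.2.1 _ (mem_FU.2 ⟨F, subset_refl F, hfin, hne, rfl⟩)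

theorem isUPS_finpow (hW : IsInfinite W) : IsUPS W (sep (finpow W) fun s => s ≠ emp) := by
  refine ⟨fun x hx => (mem_sep.1 hx).1, fun h => (mem_sep.1 h).2 rfl, fun a b ha hb _ => ?_,
    fun a ha => ?_⟩
  · obtain ⟨h1, h2⟩ := mem_sep.1 ha
    obtain ⟨h3, -⟩ := mem_sep.1 hb
    obtain ⟨h1, h1'⟩ := mem_finpow.1 h1
    obtain ⟨h3, h3'⟩ := mem_finpow.1 h3
    refine mem_sep.2 ⟨mem_finpow.2 ⟨fun z hz => ?_, finite_un h1' h3'⟩, ?_⟩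
    · rcases mem_un.1 hz with hz | hz
      · exact h1 z hz
      · exact h3 z hz
    · obtain ⟨x, hx⟩ := ne_emp_iff.1 h2
      exact ne_emp_iff.2 ⟨x, mem_un.2 (Or.inl hx)⟩
  · obtain ⟨z, hz⟩ := (hW.diff ha).exists_mem
    obtain ⟨hz, hza⟩ := mem_diff.1 hz
    refine ⟨sing z, mem_sep.2 ⟨mem_finpow.2 ⟨fun t ht => ?_, finite_sing z⟩,
      ne_emp_iff.2 ⟨z, by simp⟩⟩, fun t ht => ?_⟩
    · rw [mem_sing] at ht
      rwa [ht]
    · rw [mem_sing] at ht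
      rwa [ht]

theorem isFinitePowerset_iff {P X : M} : IsFinitePowerset P X ↔ P = finpow X :=
  ⟨fun h => ext fun z => by rw [h z, mem_finpow], fun h z => by rw [h, mem_finpow]⟩

theorem isFiniteUnions_iff {U Y : M} : IsFiniteUnions U Y ↔ U = FU Y := by
  have key : ∀ u : M, (∃ F, IsSubset F Y ∧ IsFinite F ∧ ¬ IsEmptySet F ∧ IsUnion u F) ↔
      u ∈ᴹ FU Y := fun u => by simp only [mem_FU, isEmptySet_iff, isUnion_iff, Ne]
  exact ⟨fun h => ext fun u => by rw [h u, key], fun h u => by rw [h, key]⟩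

theorem ht_of_finEqDFin (h : FinEqDFin M) : HT M := by
  intro X hX P t c hP ht hc
  rw [isFinitePowerset_iff] at hP
  subst hP
  obtain ⟨W, f, hWX, hW, hf⟩ := (h X hX).exists_countable
  have hch := choosable_finpow_of_injection hf
  have hsub : IsSubset (finpow W) (finpow X) := fun s hs => by
    obtain ⟨h1, h2⟩ := mem_finpow.1 hs
    exact mem_finpow.2 ⟨h1.trans hWX, h2⟩
  let C := sep (finpow W) fun s => s ≠ emp
  have hC : IsUPS W C := isUPS_finpow hW
  -- Every nonempty finite set has one of the two colours, and a family as in `IsUPS` is never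
  -- empty.
  have hlarge : Large W
      (un (sep C fun s => app c s = emp) (sep C fun s => app c s = ins emp emp)) C := by
    intro C' h1 h2
    obtain ⟨x, hx, -⟩ := h2.2.2.2 emp finite_emp
    have hxC := h1 x hx
    refine ⟨x, hx, ?_⟩
    exact mem_un.2 (((isTwo_mem ht).1 (hc.app_mem (hsub x (hC.1 x hxC)))).imp
      (fun h => mem_sep.2 ⟨hxC, h⟩) fun h => mem_sep.2 ⟨hxC, h⟩)
  have hmain : ∃ i C', IsSubset C' C ∧ IsUPS W C' ∧ Large W (sep C fun s => app c s = i) C' := by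
    rcases large_un hlarge with h' | ⟨C', h1, h2, h3⟩
    · exact ⟨_, C, subset_refl C, hC, h'⟩
    · exact ⟨_, C', h1, h2, h3⟩
  obtain ⟨i, C', h1, h2, h3⟩ := hmain
  obtain ⟨D, hDC, hD, hDpw, hDX⟩ := h3.exists_FU_subset hch h2
  refine ⟨D, FU D, (hDC.trans h1).trans (hC.1.trans hsub), hD, hDpw, isFiniteUnions_iff.2 rfl, i,
    fun s hs => ?_⟩
  obtain ⟨hs, hsi⟩ := mem_sep.1 (hDX s hs)
  rw [maps_iff, ← hsi]
  exact hc.maps_app (hsub s (hC.1 s hs))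

end Hindman

/-! ### König's lemma from Ramsey's theorem -/

section Konig

variable {M : Type u} [setLang.Structure M] [hM : ZF M]

/-- The first component of an ordered pair. -/
noncomputable def fst (p : M) : M := sUnion (sep (sUnion p) fun x => ∃ y, p = opair x y)

/-- The second component of an ordered pair. -/
noncomputable def snd (p : M) : M := sUnion (sep (sUnion p) fun y => ∃ x, p = opair x y)

instance DefF.fst (f : (ℕ → M) → M) [DefF f] : DefF (fun w => fst (f w)) :=
  DefF.comp₁ (F := SetModel.fst) (by unfold SetModel.fst; infer_instance) f

instance DefF.snd (f : (ℕ → M) → M) [DefF f] : DefF (fun w => snd (f w)) :=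
  DefF.comp₁ (F := SetModel.snd) (by unfold SetModel.snd; infer_instance) f

@[simp] theorem fst_opair (x y : M) : fst (opair x y) = x :=
  sUnion_sep_eq (P := fun z => ∃ t, opair x y = opair z t)
    (mem_sUnion.2 ⟨sing x, by simp [opair], by simp⟩) ⟨y, rfl⟩
    fun _ _ ⟨_, h⟩ => (opair_inj.1 h).1.symm

@[simp] theorem snd_opair (x y : M) : snd (opair x y) = y :=
  sUnion_sep_eq (P := fun z => ∃ t, opair x y = opair t z)
    (mem_sUnion.2 ⟨upair x y, by simp [opair], by simp⟩) ⟨x, rfl⟩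
    fun _ _ ⟨_, h⟩ => (opair_inj.1 h).2.symm

/-- `g` is a choice function on `B`. -/
def IsChoice (g B : M) : Prop := IsFunction g B (sUnion B) ∧ ∀ a, a ∈ᴹ B → app g a ∈ᴹ a

instance DefP.isChoice (f g : (ℕ → M) → M) [DefF f] [DefF g] :
    DefP (fun w => IsChoice (f w) (g w)) :=
  DefP.comp₂ (R := IsChoice) (by unfold IsChoice; infer_instance) f g

theorem isChoice_lam {B : M} {F : M → M} [DefF (fun w => F (w 0))]
    (h : ∀ a, a ∈ᴹ B → F a ∈ᴹ a) : IsChoice (lam B F) B :=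
  ⟨isFunction_lam fun a ha => mem_sUnion.2 ⟨a, ha, h a ha⟩, fun a ha => by
    rw [app_lam ha]
    exact h a ha⟩

open Classical in
theorem exists_isChoice {B : M} (hB : IsFinite B) (h : ∀ a, a ∈ᴹ B → ∃ x, x ∈ᴹ a) :
    ∃ g, IsChoice g B := by
  refine finite_induction (fun B => (∀ a, a ∈ᴹ B → ∃ x, x ∈ᴹ a) → ∃ g, IsChoice g B) ?_ ?_ B hB h
  · intro _
    exact ⟨_, isChoice_lam (F := fun x => x) fun a ha => (mem_emp ha).elim⟩
  · intro a s _ ha ih h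
    obtain ⟨g, hg⟩ := ih fun b hb => h b (mem_ins.2 (Or.inl hb))
    obtain ⟨y, hy⟩ := h a (by simp)
    refine ⟨_, isChoice_lam (F := fun x => if x = a then y else app g x) fun b hb => ?_⟩
    by_cases hba : b = a
    · simpa [hba] using hy
    · simpa [hba] using hg.2 b ((mem_ins.1 hb).resolve_right hba)

theorem IsChoice.subset_prod {g B : M} (hg : IsChoice g B) : IsSubset g (prod B (sUnion B)) :=
  fun p hp => by
    obtain ⟨x, y, hx, hy, h⟩ := hg.1.1 p hp
    rw [isOrderedPair_iff.1 h]
    exact opair_mem_prod.2 ⟨hx, hy⟩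

open Classical in
theorem kl_of_rt (hRT : RT M) : KL M := by
  intro A hA hAfin
  obtain ⟨w, h, hw, hh⟩ := hA
  rw [isOmega_iff] at hw
  subst hw
  -- `An n` collects the members with index below `n`, and `X` below consists of the pairs `(n, g)`
  -- with `g` a choice function on `An n`. Finite choice makes `X` infinite without choosing any
  -- `g`.
  let An : M → M := fun n => sep A fun a => app h a ∈ᴹ n
  have mem_An : ∀ {n a}, a ∈ᴹ An n ↔ a ∈ᴹ A ∧ app h a ∈ᴹ n := mem_sep
  have An_fin : ∀ n, n ∈ᴹ omg → IsFinite (An n) := fun n hn =>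
    finite_of_injection (f := lam (An n) fun a => app h a) (finite_nat hn)
      (isInjection_lam (fun a ha => (mem_An.1 ha).2) fun a b ha hb =>
        hh.app_inj (mem_An.1 ha).1 (mem_An.1 hb).1)
  let X := sep (prod omg (pow (prod A (sUnion A)))) fun p => IsChoice (snd p) (An (fst p))
  have mem_X : ∀ {p}, p ∈ᴹ X → ∃ n g, p = opair n g ∧ n ∈ᴹ omg ∧ IsChoice g (An n) := by
    intro p hp
    obtain ⟨hp, hg⟩ := mem_sep.1 hp
    obtain ⟨n, g, hn, -, rfl⟩ := mem_prod.1 hp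
    rw [fst_opair, snd_opair] at hg
    exact ⟨n, g, rfl, hn, hg⟩
  have X_mem : ∀ {n g}, n ∈ᴹ omg → IsChoice g (An n) → opair n g ∈ᴹ X := by
    intro n g hn hg
    refine mem_sep.2 ⟨opair_mem_prod.2 ⟨hn, mem_pow.2 fun p hp => ?_⟩, by simpa using hg⟩
    obtain ⟨x, y, hx, hy, rfl⟩ := mem_prod.1 (hg.subset_prod p hp)
    obtain ⟨z, hz, hyz⟩ := mem_sUnion.1 hy
    exact opair_mem_prod.2 ⟨(mem_An.1 hx).1, mem_sUnion.2 ⟨z, (mem_An.1 hz).1, hyz⟩⟩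
  have hX : IsInfinite X := by
    intro hfin
    refine infinite_omg (finite_subset (finite_img hfin fun p => fst p) fun n hn => ?_)
    obtain ⟨g, hg⟩ := exists_isChoice (An_fin n hn) fun a ha =>
      ne_emp_iff.1 fun h => (hAfin a (mem_An.1 ha).1).1 (isEmptySet_iff.2 h)
    exact mem_img.2 ⟨_, X_mem hn hg, (fst_opair n g).symm⟩
  let Q := sep (pow X) fun s => ∃ x y, x ∈ᴹ X ∧ y ∈ᴹ X ∧ x ≠ y ∧ s = upair x y
  have hQ : ∀ s, s ∈ᴹ Q ↔ ∃ x y, x ∈ᴹ X ∧ y ∈ᴹ X ∧ x ≠ y ∧ s = upair x y := by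
    intro s
    rw [mem_sep, mem_pow, and_iff_right_iff_imp]
    rintro ⟨x, y, hx, hy, -, rfl⟩ z hz
    rcases mem_upair.1 hz with rfl | rfl <;> assumption
  let col : M → M := fun s =>
    if ∃ x y, x ∈ᴹ s ∧ y ∈ᴹ s ∧ x ≠ y ∧ fst x = fst y then emp else ins emp emp
  have hcol : ∀ x y, x ≠ y → (col (upair x y) = emp ↔ fst x = fst y) := by
    intro x y hxy
    by_cases he : fst x = fst y
    · have : ∃ x' y', x' ∈ᴹ upair x y ∧ y' ∈ᴹ upair x y ∧ x' ≠ y' ∧ fst x' = fst y' :=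
        ⟨x, y, by simp, by simp, hxy, he⟩
      simp only [col, if_pos this, he]
    · have : ¬ ∃ x' y', x' ∈ᴹ upair x y ∧ y' ∈ᴹ upair x y ∧ x' ≠ y' ∧ fst x' = fst y' := by
        rintro ⟨x', y', hx', hy', hne, he'⟩
        rcases mem_upair.1 hx' with rfl | rfl <;> rcases mem_upair.1 hy' with rfl | rfl
        · exact hne rfl
        · exact he he'
        · exact he he'.symm
        · exact hne rfl
      simp only [col, if_neg this, he, iff_false]
      exact emp_ne_one.symm
  obtain ⟨t, ht⟩ := exists_isTwo (M := M)
  have hc : IsFunction (lam Q col) Q t := isFunction_lam fun s _ => by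
    rw [isTwo_mem ht]
    by_cases h : ∃ x y, x ∈ᴹ s ∧ y ∈ᴹ s ∧ x ≠ y ∧ fst x = fst y
    · exact Or.inl (if_pos h)
    · exact Or.inr (if_neg h)
  obtain ⟨Y, R, hYX, hY, hR, i, hi⟩ := hRT X hX Q t (lam Q col) (isPairSet_iff.2 hQ) ht hc
  rw [isPairSet_iff] at hR
  have hmono : ∀ x y, x ∈ᴹ Y → y ∈ᴹ Y → x ≠ y → col (upair x y) = i := by
    intro x y hx hy hxy
    have := maps_iff.1 (hi _ ((hR _).2 ⟨x, y, hx, hy, hxy, rfl⟩))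
    exact (mem_lam.1 this).2.symm
  -- One agreement of first components forces colour `emp`, hence a common first component `n`
  -- throughout `Y`; but the relations between `An n` and its union are finite in number, so `Y`
  -- would be finite.
  have hinj : ∀ x y, x ∈ᴹ Y → y ∈ᴹ Y → fst x = fst y → x = y := by
    intro x y hx hy hxy
    by_contra hne
    have hi0 : i = emp := by rw [← hmono x y hx hy hne, hcol x y hne]; exact hxy
    have hall : ∀ z, z ∈ᴹ Y → fst z = fst x := by
      intro z hz
      by_cases hzx : z = x
      · rw [hzx]
      · rw [← hcol z x hzx, hmono z x hz hx hzx, hi0]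
    obtain ⟨n, g, hxn, hn, hg⟩ := mem_X (hYX x hx)
    have hxn' : fst x = n := by rw [hxn, fst_opair]
    have hU : IsFinite (sUnion (An n)) :=
      finite_sUnion (An_fin n hn) fun a ha => (hAfin a (mem_An.1 ha).1).2
    refine hY (finite_subset (finite_img (finite_pow (finite_prod (An_fin n hn) hU))
      fun g => opair n g) fun z hz => ?_)
    obtain ⟨m, g', rfl, hm, hg'⟩ := mem_X (hYX z hz)
    obtain rfl : m = n := by rw [← hxn', ← hall _ hz, fst_opair]
    exact mem_img.2 ⟨g', mem_pow.2 hg'.subset_prod, rfl⟩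
  have hYn : ∀ p, p ∈ᴹ Y → fst p ∈ᴹ omg := by
    intro p hp
    obtain ⟨n, g, rfl, hn, -⟩ := mem_X (hYX p hp)
    rwa [fst_opair]
  -- First components are unbounded on `Y`: otherwise `Y` would inject into the successor of `app h
  -- a`.
  have hex : ∀ a, a ∈ᴹ A → ∃ p, p ∈ᴹ Y ∧ app h a ∈ᴹ fst p := by
    intro a ha
    by_contra hcon
    push Not at hcon
    have hk := hh.1.app_mem ha
    refine hY (finite_of_injection (f := lam Y fun p => fst p) (finite_nat (succ_mem_omg hk))
      (isInjection_lam (fun p hp => ?_) hinj))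
    rcases nat_trichotomy hk (hYn p hp) with h' | h' | h'
    · exact mem_ins.2 (Or.inl h')
    · exact mem_ins.2 (Or.inr h')
    · exact (hcon p hp h').elim
  -- The least available `n` determines a unique pair in `Y`, because first components are injective
  -- there. This makes the selection canonical.
  let sel : M → M := fun a => sUnion (sep Y fun p => app h a ∈ᴹ fst p ∧
    ∀ q, q ∈ᴹ Y → app h a ∈ᴹ fst q → fst p ∈ᴹ fst q ∨ fst p = fst q)
  have hsel : ∀ a, a ∈ᴹ A → sel a ∈ᴹ Y ∧ app h a ∈ᴹ fst (sel a) := by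
    intro a ha
    obtain ⟨p₀, hp₀, hp₀'⟩ := hex a ha
    obtain ⟨n, hn, hn'⟩ := exists_least (s := img (sep Y fun p => app h a ∈ᴹ fst p) fun p => fst p)
      (fun n hn => by
        obtain ⟨p, hp, rfl⟩ := mem_img.1 hn
        exact hYn p (mem_sep.1 hp).1)
      ⟨_, mem_img.2 ⟨p₀, mem_sep.2 ⟨hp₀, hp₀'⟩, rfl⟩⟩
    obtain ⟨p, hp, rfl⟩ := mem_img.1 hn
    obtain ⟨hp, hap⟩ := mem_sep.1 hp
    have hmin : ∀ q, q ∈ᴹ Y → app h a ∈ᴹ fst q → fst p ∈ᴹ fst q ∨ fst p = fst q :=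
      fun q hq haq => hn' _ (mem_img.2 ⟨q, mem_sep.2 ⟨hq, haq⟩, rfl⟩)
    have : sel a = p := sUnion_sep_eq (P := fun p => app h a ∈ᴹ fst p ∧
      ∀ q, q ∈ᴹ Y → app h a ∈ᴹ fst q → fst p ∈ᴹ fst q ∨ fst p = fst q) hp ⟨hap, hmin⟩
      fun q hq ⟨haq, hq'⟩ => by
        rcases hq' p hp hap with h1 | h1
        · rcases hmin q hq haq with h2 | h2
          · exact (mem_asymm h1 h2).elim
          · exact hinj q p hq hp h2.symm
        · exact hinj q p hq hp h1
    rw [this]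
    exact ⟨hp, hap⟩
  have hfin := isChoice_lam (B := A) (F := fun a => app (snd (sel a)) a) fun a ha => by
    obtain ⟨h1, h2⟩ := hsel a ha
    obtain ⟨n, g, hng, hn, hg⟩ := mem_X (hYX _ h1)
    rw [hng, fst_opair] at h2
    simp only [hng, snd_opair]
    exact hg.2 a (mem_An.2 ⟨ha, h2⟩)
  refine ⟨sUnion A, _, isUnion_iff.2 rfl, hfin.1, fun a y hay => ?_⟩
  obtain ⟨ha, rfl⟩ := hfin.1.mem_iff.1 (maps_iff.1 hay)
  exact hfin.2 a ha

end Konig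

/-! ### Doubling of cardinalities, and Dedekind-infiniteness from König and Hindman -/

section Counting

variable {M : Type u} [setLang.Structure M] [hM : ZF M]

theorem card_congr {s t : M} (hs : IsFinite s) (h : Inj s t) (h' : Inj t s) : card s = card t := by
  obtain ⟨h1, h2, h3⟩ := card_spec hs
  exact (card_eq h1 (h'.trans h2) (h3.trans h)).symm

theorem card_nat {n : M} (hn : n ∈ᴹ omg) : card n = n :=
  card_eq hn (Inj.of_subset (subset_refl n)) (Inj.of_subset (subset_refl n))

theorem eq_emp_of_card {s : M} (hs : IsFinite s) (h : card s = emp) : s = emp := by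
  obtain ⟨-, ⟨f, hf⟩, -⟩ := card_spec hs
  rw [h] at hf
  exact isEmptySet_iff.1 fun z hz => mem_emp (hf.1.app_mem hz)

/-- The number `2 n`. -/
noncomputable def dbl (n : M) : M := card (prod n (upair emp (ins emp emp)))

instance DefF.dbl (f : (ℕ → M) → M) [DefF f] : DefF (fun w => dbl (f w)) :=
  DefF.comp₁ (F := SetModel.dbl) (by unfold SetModel.dbl; infer_instance) f

theorem dbl_spec {n : M} (hn : n ∈ᴹ omg) : dbl n ∈ᴹ omg ∧
    Inj (prod n (upair emp (ins emp emp))) (dbl n) ∧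
    Inj (dbl n) (prod n (upair emp (ins emp emp))) :=
  card_spec (finite_prod (finite_nat hn) (finite_upair _ _))

theorem dbl_emp : dbl (emp : M) = emp := by
  have : prod emp (upair emp (ins emp emp)) = (emp : M) := isEmptySet_iff.1 fun z hz => by
    obtain ⟨x, y, hx, -⟩ := mem_prod.1 hz
    exact mem_emp hx
  rw [dbl, this, card_nat emp_mem_omg]

theorem prod_mono {A A' B B' : M} (h : IsSubset A A') (h' : IsSubset B B') :
    IsSubset (prod A B) (prod A' B') := fun p hp => by
  obtain ⟨x, y, hx, hy, rfl⟩ := mem_prod.1 hp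
  exact opair_mem_prod.2 ⟨h x hx, h' y hy⟩

/-- If `m < n` had equal doubles, the finite set `n × 2` would inject into its proper subset `m ×
2`. -/
theorem dbl_inj {m n : M} (hm : m ∈ᴹ omg) (hn : n ∈ᴹ omg) (h : dbl m = dbl n) : m = n := by
  have key : ∀ m n : M, n ∈ᴹ omg → m ∈ᴹ n → dbl m ≠ dbl n := by
    intro m n hn hmn he
    have hm := mem_omg_of_mem hn hmn
    obtain ⟨f, hf⟩ := (dbl_spec hn).2.1.trans (he ▸ (dbl_spec hm).2.2)
    have := eq_of_injection_subset (finite_prod (finite_nat hn) (finite_upair _ _)) hf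
      (prod_mono (subset_of_mem_nat hn hmn) (subset_refl _))
    have h1 : opair m emp ∈ᴹ prod n (upair emp (ins emp emp)) := by simp [hmn]
    rw [← this] at h1
    exact mem_irrefl m (opair_mem_prod.1 h1).1
  rcases nat_trichotomy hm hn with h' | h' | h'
  · exact (key n m hm h' h.symm).elim
  · exact h'.symm
  · exact (key m n hn h' h).elim

/-- Otherwise `n × 2` would inject into `n`, hence into its proper subset `n × {0}`. This strict
increase drives the descents in `exists_dbl_alternating`. -/
theorem mem_dbl {n : M} (hn : n ∈ᴹ omg) (hne : n ≠ emp) : n ∈ᴹ dbl n := by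
  have key : ¬ IsSubset (dbl n) n := by
    intro hsub
    have h1 : Inj n (prod n (sing emp)) :=
      ⟨lam n fun k => opair k emp, isInjection_lam (fun k hk => by simpa using hk)
        fun k l _ _ h => (opair_inj.1 h).1⟩
    obtain ⟨f, hf⟩ := (((dbl_spec hn).2.1).trans (Inj.of_subset hsub)).trans h1
    have := eq_of_injection_subset (finite_prod (finite_nat hn) (finite_upair _ _)) hf
      (prod_mono (subset_refl n) fun z hz => by
        rw [mem_sing] at hz
        simp [hz])
    obtain ⟨k, hk⟩ := ne_emp_iff.1 hne
    have h2 : opair k (ins emp emp) ∈ᴹ prod n (upair emp (ins emp emp)) := by simp [hk]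
    rw [← this] at h2
    exact emp_ne_one (mem_sing.1 (opair_mem_prod.1 h2).2).symm
  rcases nat_trichotomy hn (dbl_spec hn).1 with h | h | h
  · exact (key (subset_of_mem_nat hn h)).elim
  · exact (key (by rw [h]; exact subset_refl n)).elim
  · exact h

open Classical in
theorem card_un_eq_dbl {a b n : M} (ha : IsFinite a) (hb : IsFinite b) (hab : Disj a b)
    (han : card a = n) (hbn : card b = n) : card (un a b) = dbl n := by
  obtain ⟨hn, ⟨f, hf⟩, ⟨f', hf'⟩⟩ := card_spec ha
  obtain ⟨-, ⟨g, hg⟩, ⟨g', hg'⟩⟩ := card_spec hb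
  rw [han] at hn hf hf'
  rw [hbn] at hg hg'
  have hb' : ∀ x, x ∈ᴹ un a b → ¬ x ∈ᴹ a → x ∈ᴹ b := fun x hx hxa => (mem_un.1 hx).resolve_left hxa
  refine card_congr (finite_un ha hb) ⟨lam (un a b) fun x =>
    if x ∈ᴹ a then opair (app f x) emp else opair (app g x) (ins emp emp), isInjection_lam ?_ ?_⟩
    ⟨lam (prod n (upair emp (ins emp emp))) fun p =>
      if snd p = emp then app f' (fst p) else app g' (fst p), isInjection_lam ?_ ?_⟩
  · intro x hx
    by_cases hxa : x ∈ᴹ a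
    · simpa [hxa] using hf.1.app_mem hxa
    · simpa [hxa] using hg.1.app_mem (hb' x hx hxa)
  · intro x y hx hy h
    by_cases hxa : x ∈ᴹ a <;> by_cases hya : y ∈ᴹ a <;>
      simp only [hxa, hya, if_true, if_false, opair_inj] at h
    · exact hf.app_inj hxa hya h.1
    · exact (emp_ne_one h.2).elim
    · exact (emp_ne_one h.2.symm).elim
    · exact hg.app_inj (hb' x hx hxa) (hb' y hy hya) h.1
  · intro p hp
    obtain ⟨k, i, hk, -, rfl⟩ := mem_prod.1 hp
    by_cases hi : i = emp
    · simpa [hi] using Or.inl (hf'.1.app_mem hk)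
    · simpa [hi] using Or.inr (hg'.1.app_mem hk)
  · intro p q hp hq h
    obtain ⟨k, i, hk, hi, rfl⟩ := mem_prod.1 hp
    obtain ⟨l, j, hl, hj, rfl⟩ := mem_prod.1 hq
    rw [mem_upair] at hi hj
    by_cases hi0 : i = emp <;> by_cases hj0 : j = emp <;>
      simp only [fst_opair, snd_opair, hi0, hj0, if_true, if_false] at h
    · rw [hi0, hj0, hf'.app_inj hk hl h]
    · have h1 := hf'.1.app_mem hk
      rw [h] at h1
      exact (hab _ h1 (hg'.1.app_mem hl)).elim
    · have h1 := hf'.1.app_mem hl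
      rw [← h] at h1
      exact (hab _ h1 (hg'.1.app_mem hk)).elim
    · rw [hi.resolve_left hi0, hj.resolve_left hj0, hg'.app_inj hk hl h]

/-- There is a set of natural numbers that contains exactly one of `n` and `2 n`, for `n ≠ 0`. -/
theorem exists_dbl_alternating : ∃ S : M, ∀ n, n ∈ᴹ omg → n ≠ emp → (n ∈ᴹ S ↔ ¬ dbl n ∈ᴹ S) := by
  -- `S` is generated from the numbers that are not doubles by `n ↦ 4n`: these are the nonzero
  -- numbers in which 2 has even exponent.
  let Closed : M → Prop := fun R =>
    (∀ n, n ∈ᴹ omg → (¬ ∃ m, m ∈ᴹ omg ∧ n = dbl m) → n ∈ᴹ R) ∧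
      ∀ n, n ∈ᴹ omg → n ∈ᴹ R → dbl (dbl n) ∈ᴹ R
  let S := sep omg fun n => ∀ R, Closed R → n ∈ᴹ R
  have mem_S : ∀ {n}, n ∈ᴹ S ↔ n ∈ᴹ omg ∧ ∀ R, Closed R → n ∈ᴹ R := mem_sep
  clear_value S
  have h0 : ∀ n, n ∈ᴹ omg → (¬ ∃ m, m ∈ᴹ omg ∧ n = dbl m) → n ∈ᴹ S :=
    fun n hn h => mem_S.2 ⟨hn, fun R hR => hR.1 n hn h⟩
  have hs : ∀ n, n ∈ᴹ S → dbl (dbl n) ∈ᴹ S := fun n hn => by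
    obtain ⟨hn, h⟩ := mem_S.1 hn
    exact mem_S.2 ⟨(dbl_spec (dbl_spec hn).1).1, fun R hR => hR.2 n hn (h R hR)⟩
  have hinv : ∀ n, n ∈ᴹ S → (∃ m, m ∈ᴹ omg ∧ n = dbl m) → ∃ k, k ∈ᴹ S ∧ n = dbl (dbl k) := by
    intro n hn hm
    by_contra hcon
    push Not at hcon
    have : Closed (diff S (sing n)) := by
      refine ⟨fun k hk hk' => ?_, fun k _ hk => ?_⟩
      · simp only [mem_diff, mem_sing]
        refine ⟨h0 k hk hk', ?_⟩
        rintro rfl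
        exact hk' hm
      · simp only [mem_diff, mem_sing] at hk ⊢
        exact ⟨hs k hk.1, fun he => hcon k hk.1 he.symm⟩
    have := (mem_S.1 hn).2 _ this
    simp at this
  have hne : ∀ n m : M, n = dbl m → n ≠ emp → m ≠ emp := by
    rintro n m rfl h rfl
    exact h dbl_emp
  refine ⟨S, fun n hn hn0 => ⟨fun hnS hdS => ?_, fun hdS => ?_⟩⟩
  · obtain ⟨n, hn, hmin⟩ := exists_least (s := sep omg fun n => n ≠ emp ∧ n ∈ᴹ S ∧ dbl n ∈ᴹ S)
      (fun x hx => (mem_sep.1 hx).1) ⟨n, mem_sep.2 ⟨hn, hn0, hnS, hdS⟩⟩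
    obtain ⟨hn, hn0, hnS, hdS⟩ := mem_sep.1 hn
    obtain ⟨m, hm, hnm⟩ := hinv _ hdS ⟨n, hn, rfl⟩
    have hmo := (mem_S.1 hm).1
    have hnm := dbl_inj hn (dbl_spec hmo).1 hnm
    have hm0 := hne n m hnm hn0
    have hlt := mem_dbl hmo hm0
    rw [← hnm] at hlt
    rcases hmin m (mem_sep.2 ⟨hmo, hm0, hm, hnm ▸ hnS⟩) with h | h
    · exact mem_asymm h hlt
    · exact mem_irrefl _ (h ▸ hlt)
  · by_contra hnS
    -- Descent: if neither `n` nor `2n` is in `S`, then `n = 2m`, and `m ∈ S` would put `4m = 2n` in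
    -- `S`; so `m` is a smaller example.
    obtain ⟨n, hn, hmin⟩ := exists_least
      (s := sep omg fun n => n ≠ emp ∧ ¬ n ∈ᴹ S ∧ ¬ dbl n ∈ᴹ S)
      (fun x hx => (mem_sep.1 hx).1) ⟨n, mem_sep.2 ⟨hn, hn0, hnS, hdS⟩⟩
    obtain ⟨hn, hn0, hnS, hdS⟩ := mem_sep.1 hn
    obtain ⟨m, hmo, hnm⟩ : ∃ m, m ∈ᴹ omg ∧ n = dbl m := by
      by_contra h
      exact hnS (h0 n hn h)
    have hm0 := hne n m hnm hn0
    have hlt := mem_dbl hmo hm0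
    rw [← hnm] at hlt
    rcases hmin m (mem_sep.2 ⟨hmo, hm0, fun hm => hdS (hnm ▸ hs m hm), hnm ▸ hnS⟩) with h | h
    · exact mem_asymm h hlt
    · exact mem_irrefl _ (h ▸ hlt)

/-- The greedy construction with all finite subsets of `Y` admissible; `Y` inherits choosability
from `ω`. -/
theorem isDedekindInfinite_of_injection {Y f : M} (hY : IsInfinite Y)
    (hf : IsInjection f Y omg) : IsDedekindInfinite Y := by
  obtain ⟨D, hDY, hD, -⟩ := exists_infinite_of_extension (G := finpow Y)
    (choosable_of_injection hf choosable_omg)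
    (mem_finpow.2 ⟨emp_subset Y, finite_emp⟩) (fun E hE => (mem_finpow.1 hE).1)
    (fun E F hE hF => mem_finpow.2
      ⟨hF.trans (mem_finpow.1 hE).1, finite_subset (mem_finpow.1 hE).2 hF⟩)
    (fun E hE => by
      obtain ⟨h1, h2⟩ := mem_finpow.1 hE
      obtain ⟨d, hd⟩ := (hY.diff h2).exists_mem
      obtain ⟨hd, hdE⟩ := mem_diff.1 hd
      exact ⟨d, hd, hdE, mem_finpow.2 ⟨ins_subset hd h1, finite_ins d h2⟩⟩)
  obtain ⟨g, hg⟩ := isDedekindInfinite_iff.1 hD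
  exact isDedekindInfinite_iff.2 (Inj.trans ⟨g, hg⟩ (Inj.of_subset hDY))

open Classical in
theorem finEqDFin_of_kl_ht (hKL : KL M) (hHT : HT M) : FinEqDFin M := by
  intro X hX
  obtain ⟨S, hS⟩ := exists_dbl_alternating (M := M)
  obtain ⟨t, ht⟩ := exists_isTwo (M := M)
  let col : M → M := fun s => if card s ∈ᴹ S then emp else ins emp emp
  obtain ⟨Y, U, hYX, hY, hYpw, hU, i, hi⟩ := hHT X hX (finpow X) t (lam (finpow X) col)
    (isFinitePowerset_iff.2 rfl) ht (isFunction_lam fun s _ => by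
      rw [isTwo_mem ht]
      by_cases h : card s ∈ᴹ S
      · exact Or.inl (if_pos h)
      · exact Or.inr (if_neg h))
  rw [isFiniteUnions_iff] at hU
  subst hU
  have hmono : ∀ s, s ∈ᴹ FU Y → (card s ∈ᴹ S ↔ i = emp) := by
    intro s hs
    have := (mem_lam.1 (maps_iff.1 (hi s hs))).2
    rw [this]
    by_cases h : card s ∈ᴹ S
    · simp only [col, if_pos h, h]
    · simp only [col, if_neg h, h, false_iff]
      exact emp_ne_one.symm
  have hfin : ∀ s, s ∈ᴹ Y → IsFinite s := fun s hs => (mem_finpow.1 (hYX s hs)).2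
  -- Equal nonzero cardinalities would put `card a` and its double on the same side of `S`.
  -- Cardinality zero is separate, since zero is its own double; there both sets are empty.
  have hinj : ∀ a b, a ∈ᴹ Y → b ∈ᴹ Y → card a = card b → a = b := by
    intro a b ha hb hab
    by_contra hne
    by_cases h0 : card a = emp
    · exact hne ((eq_emp_of_card (hfin a ha) h0).trans
        (eq_emp_of_card (hfin b hb) (hab ▸ h0)).symm)
    have h1 := card_un_eq_dbl (hfin a ha) (hfin b hb)
      (fun z hza hzb => hYpw a b ha hb hne z ⟨hza, hzb⟩) rfl hab.symm
    have h2 : un a b ∈ᴹ FU Y := mem_FU.2 ⟨upair a b, fun z hz => by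
      rcases mem_upair.1 hz with rfl | rfl <;> assumption, finite_upair a b,
      ne_emp_iff.2 ⟨a, by simp⟩, rfl⟩
    have h3 := hS (card a) (card_spec (hfin a ha)).1 h0
    rw [← h1, hmono _ h2, hmono _ (mem_FU_of_mem ha)] at h3
    exact iff_not_self h3
  -- `Y` may contain the empty set, from which König's lemma cannot choose; deleting it leaves an
  -- infinite family.
  have hY₀ : IsInfinite (diff Y (sing emp)) := hY.diff (finite_sing emp)
  have hsub : IsSubset (diff Y (sing emp)) Y := fun z hz => (mem_diff.1 hz).1
  have hcard : IsInjection (lam (diff Y (sing emp)) fun s => card s) (diff Y (sing emp)) omg :=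
    isInjection_lam (fun s hs => (card_spec (hfin s (hsub s hs))).1)
      fun a b ha hb => hinj a b (hsub a ha) (hsub b hb)
  obtain ⟨V, f, hV, hf, hfmem⟩ := hKL (diff Y (sing emp)) ⟨omg, _, isOmega_iff.2 rfl, hcard⟩
    fun a ha => ⟨fun h => (mem_diff.1 ha).2 (mem_sing.2 (isEmptySet_iff.1 h)), hfin a (hsub a ha)⟩
  have hval : ∀ a, a ∈ᴹ diff Y (sing emp) → app f a ∈ᴹ a := fun a ha =>
    hfmem a _ (maps_iff.2 (hf.maps_app ha))
  obtain ⟨g, hg⟩ := isDedekindInfinite_iff.1 (isDedekindInfinite_of_injection hY₀ hcard)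
  refine isDedekindInfinite_iff.2 (Inj.trans ⟨g, hg⟩
    ⟨lam (diff Y (sing emp)) fun a => app f a, isInjection_lam (fun a ha => ?_) ?_⟩)
  · exact (mem_finpow.1 (hYX a (hsub a ha))).1 _ (hval a ha)
  · intro a b ha hb h
    by_contra hne
    exact hYpw a b (hsub a ha) (hsub b hb) hne (app f a) ⟨hval a ha, h ▸ hval b hb⟩

end Counting

end SetModel

theorem mainTheorem6 (M : Type*) [SetModel.setLang.Structure M] (hM : SetModel.IsModelOfZF M) :
    List.TFAE [SetModel.FinEqDFin M,
      SetModel.RT M ∧ SetModel.HT M,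
      SetModel.KL M ∧ SetModel.HT M] := by
  have : SetModel.ZF M := ⟨hM⟩
  tfae_have 1 → 2 := fun h => ⟨SetModel.rt_of_finEqDFin h, SetModel.ht_of_finEqDFin h⟩
  tfae_have 2 → 3 := fun h => ⟨SetModel.kl_of_rt h.1, h.2⟩
  tfae_have 3 → 1 := fun h => SetModel.finEqDFin_of_kl_ht h.1 h.2
  tfae_finish
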